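/- Let $k$ be a field and let $(\mathcal C,\mathbb E,\mathfrak s)$ be an extriangulated $k$-category, with higher extension bifunctors $\mathbb E^i$, $i\ge 1$ (the coend powers of $\mathbb E=\mathbb E^1$). For a full subcategory $\mathcal X\subseteq\mathcal C$ let $\mathcal X^{\perp}$ (resp. ${}^{\perp}\mathcal X$) be the full subcategory of the objects $y$ with $\mathbb E^i(x,y)=0$ (resp. $\mathbb E^i(y,x)=0$) for all $x\in\mathcal X$ and all $i\ge 1$, and let $\mathrm{add}(\mathcal X)$ be the smallest full subcategory containing $\mathcal X$ that is closed under isomorphisms, finite direct sums and direct summands. An object $x$ is projective (resp. injective) if $\mathbb E(x,-)=0$ (resp. $\mathbb E(-,x)=0$). The category $\mathcal C$ is hereditary if every functor $\mathbb E(x,-)$ is right exact, i.e. $\mathbb E(x,a)\to\mathbb E(x,b)\to\mathbb E(x,c)\to 0$ is exact for every conflation $a\rightarrowtail b\twoheadrightarrow c$. It is 0-Auslander if it is hereditary, every object $x$ admits a deflation $q\twoheadrightarrow x$ with $q$ projective, and every projective object admits an inflation into a projective-injective object. A full subcategory $\mathcal R\subseteq\mathcal C$ is rigid if it is closed under isomorphisms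 and $\mathbb E^i(r,r')=0$ for all $r,r'\in\mathcal R$ and $i\ge1$. Write $\mathcal A_{\mathcal R}$ for $\mathrm{add}$ of the union of $\mathcal R$ and the projective-injective objects. We say that $\mathcal R$ admits Bongartz completions if every injective object $y$ admits a deflation $r'\twoheadrightarrow y$ which is a right $\mathcal A_{\mathcal R}$-approximation, and every projective object $x$ admits an inflation $x\rightarrowtail r'$ which is a left $\mathcal A_{\mathcal R}$-approximation. The maximal Bongartz completion $\mathcal R_+$ is $\mathrm{add}$ of $\mathcal R$, the projective-injective objects, and all objects $u$ occurring in a conflation $u\rightarrowtail r'\twoheadrightarrow y$ with $y$ injective whose deflation is a right $\mathcal A_{\mathcal R}$-approximation. Dually, the minimal Bongartz completion $\mathcal R_-$ is $\mathrm{add}$ of $\mathcal R$, the projective-injective objects, and all objects $v$ occurring in a conflation $x\rightarrowtail r'\twoheadrightarrow v$ with $x$ projective whose inflation is a left $\mathcal A_{\mathcal R}$-approximation. For a rigid subcategory $\mathcal R\subseteq\mathcal C$ put $\mathcal Z_{\mathcal R}=\mathcal R^{\perp}\cap{}^{\perp}\mathcal R$, with the restriction of $(\mathbb E,\mathfrak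 s)$, and $\overline{\mathcal C}_{\mathcal R}=\mathcal Z_{\mathcal R}/[\mathcal R]$, where $[\mathcal R]$ is the ideal of $\mathcal Z_{\mathcal R}$ generated by the morphisms that factor through an object of $\mathcal R$, with the structure $(\overline{\mathbb E},\overline{\mathfrak s})$ induced from $\mathcal Z_{\mathcal R}$: $\overline{\mathbb E}(c,a)=\mathbb E(c,a)$, and $\overline{\mathfrak s}(\delta)$ is the class of the image of $\mathfrak s(\delta)$. **Proposition.** Let $\mathcal R\subseteq\mathcal C$ be a rigid subcategory. 1. If $\mathcal C$ is hereditary, then $\mathcal Z_{\mathcal R}$ and $\overline{\mathcal C}_{\mathcal R}$, with the structures above, are extriangulated and hereditary. Suppose from now on that $\mathcal C$ is 0-Auslander and that $\mathcal R$ admits Bongartz completions. 2. $\mathcal R_+^{\perp}=\mathcal R^{\perp}$ and ${}^{\perp}\mathcal R_-={}^{\perp}\mathcal R$. 3. The projective objects of $\mathcal Z_{\mathcal R}$ are precisely the objects of $\mathcal R_+$, and the injective objects of $\mathcal Z_{\mathcal R}$ are precisely the objects of $\mathcal R_-$. 4. The extriangulated categories $\mathcal Z_{\mathcal R}$ and $\overline{\mathcal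 C}_{\mathcal R}$ are 0-Auslander. 5. If a rigid subcategory $\mathcal Q\subseteq\mathcal C$ containing $\mathcal R$ admits Bongartz completions, then its image $\overline{\mathcal Q}$ in $\overline{\mathcal C}_{\mathcal R}$ (closed under isomorphisms) is a rigid subcategory of $\overline{\mathcal C}_{\mathcal R}$ which admits Bongartz completions. -/

import Mathlib

open CategoryTheory CategoryTheory.Limits

open scoped TensorProduct DirectSum

universe w w₁ w₂ v u z

/-! ## Linear bifunctors and higher extensions -/

/-- A `k`-linear bifunctor `E : Cᵒᵖ × C ⥤ Mod k`, written out. The module `obj c a` is `E(c, a)`;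
`pull g a` is the contravariant action of `g` on the first variable, `push c f` the covariant
action of `f` on the second variable. -/
structure LinBifunctor (k : Type z) [Field k] (C : Type u) [Category.{v} C] [Preadditive C]
    [Linear k C] where
  obj : C → C → Type w
  [addCommGroup : ∀ c a, AddCommGroup (obj c a)]
  [module : ∀ c a, Module k (obj c a)]
  pull : ∀ {c c' : C} (_ : c' ⟶ c) (a : C), obj c a →ₗ[k] obj c' a
  push : ∀ (c : C) {a a' : C} (_ : a ⟶ a'), obj c a →ₗ[k] obj c a'
  pull_id : ∀ c a, pull (𝟙 c) a = LinearMap.id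
  pull_comp : ∀ {c c' c'' : C} (g : c'' ⟶ c') (h : c' ⟶ c) (a : C),
    pull (g ≫ h) a = pull g a ∘ₗ pull h a
  push_id : ∀ c a, push c (𝟙 a) = LinearMap.id
  push_comp : ∀ (c : C) {a a' a'' : C} (f : a ⟶ a') (h : a' ⟶ a''),
    push c (f ≫ h) = push c h ∘ₗ push c f
  pull_push : ∀ {c c' a a' : C} (g : c' ⟶ c) (f : a ⟶ a'),
    pull g a' ∘ₗ push c f = push c' f ∘ₗ pull g a
  pull_add : ∀ {c c' : C} (g h : c' ⟶ c) (a : C), pull (g + h) a = pull g a + pull h a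
  pull_smul : ∀ {c c' : C} (t : k) (g : c' ⟶ c) (a : C), pull (t • g) a = t • pull g a
  push_add : ∀ (c : C) {a a' : C} (f h : a ⟶ a'), push c (f + h) = push c f + push c h
  push_smul : ∀ (c : C) {a a' : C} (t : k) (f : a ⟶ a'), push c (t • f) = t • push c f

attribute [instance] LinBifunctor.addCommGroup LinBifunctor.module

namespace LinBifunctor

variable {k : Type z} [Field k] {C : Type u} [Category.{v} C] [Preadditive C] [Linear k C]

/-- The same bifunctor with values in a larger universe. -/
def ulift (E : LinBifunctor.{w} k C) : LinBifunctor.{max u w} k C where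
  obj c a := ULift.{u} (E.obj c a)
  pull g a := ULift.moduleEquiv.symm.toLinearMap ∘ₗ E.pull g a ∘ₗ ULift.moduleEquiv.toLinearMap
  push c {_ _} f := ULift.moduleEquiv.symm.toLinearMap ∘ₗ E.push c f ∘ₗ ULift.moduleEquiv.toLinearMap
  pull_id c a := by ext x; simp [E.pull_id]
  pull_comp g h a := by ext x; simp [E.pull_comp]
  push_id c a := by ext x; simp [E.push_id]
  push_comp c {_ _ _} f h := by ext x; simp [E.push_comp]
  pull_push g f := by
    ext x
    simpa using LinearMap.congr_fun (E.pull_push g f) x.down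
  pull_add g h a := by ext x; simp [E.pull_add]
  pull_smul t g a := by ext x; simp [E.pull_smul]
  push_add c {_ _} f h := by ext x; simp [E.push_add]
  push_smul c {_ _} t f := by ext x; simp [E.push_smul]

section Coend

variable (F : LinBifunctor.{w₁} k C) (G : LinBifunctor.{w₂} k C)

/-- The direct sum over all objects `x` of `F(x, a) ⊗ G(c, x)`. -/
abbrev CoendSum (c a : C) : Type (max u w₁ w₂) :=
  ⨁ x : C, (F.obj x a ⊗[k] G.obj c x)

open Classical in
/-- The element `ξ ⊗ η` of the summand indexed by `x`. -/
noncomputable def coendTmul {c a : C} (x : C) (ξ : F.obj x a) (η : G.obj c x) : CoendSum F G c a :=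
  DirectSum.lof k C (fun x => F.obj x a ⊗[k] G.obj c x) x (ξ ⊗ₜ[k] η)

/-- The coend relations: `f^* ξ ⊗ η = ξ ⊗ f_* η` for every `f : x ⟶ x'`. -/
def coendRel (c a : C) : Submodule k (CoendSum F G c a) :=
  Submodule.span k {s | ∃ (x x' : C) (f : x ⟶ x') (ξ : F.obj x' a) (η : G.obj c x),
    s = coendTmul F G x (F.pull f a ξ) η - coendTmul F G x' ξ (G.push c f η)}

theorem pull_push_apply {c c' a a' : C} (g : c' ⟶ c) (f : a ⟶ a') (x : F.obj c a) :
    F.pull g a' (F.push c f x) = F.push c' f (F.pull g a x) :=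
  LinearMap.congr_fun (F.pull_push g f) x

/-- The action of `g : c' ⟶ c` on direct sums. -/
noncomputable def sumPull {c c' : C} (g : c' ⟶ c) (a : C) :
    CoendSum F G c a →ₗ[k] CoendSum F G c' a :=
  DirectSum.lmap fun x => TensorProduct.map LinearMap.id (G.pull g x)

/-- The action of `f : a ⟶ a'` on direct sums. -/
noncomputable def sumPush (c : C) {a a' : C} (f : a ⟶ a') :
    CoendSum F G c a →ₗ[k] CoendSum F G c a' :=
  DirectSum.lmap fun x => TensorProduct.map (F.push x f) LinearMap.id

theorem sumPull_tmul {c c' : C} (g : c' ⟶ c) (a x : C) (ξ : F.obj x a) (η : G.obj c x) :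
    sumPull F G g a (coendTmul F G x ξ η) = coendTmul F G x ξ (G.pull g x η) := by
  classical
  simp only [sumPull, coendTmul]
  erw [DirectSum.lmap_lof]
  simp

theorem sumPush_tmul (c : C) {a a' : C} (f : a ⟶ a') (x : C) (ξ : F.obj x a) (η : G.obj c x) :
    sumPush F G c f (coendTmul F G x ξ η) = coendTmul F G x (F.push x f ξ) η := by
  classical
  simp only [sumPush, coendTmul]
  erw [DirectSum.lmap_lof]
  simp

theorem sumPull_rel {c c' : C} (g : c' ⟶ c) (a : C) :
    coendRel F G c a ≤ (coendRel F G c' a).comap (sumPull F G g a) := by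
  refine Submodule.span_le.2 ?_
  rintro _ ⟨x, x', f, ξ, η, rfl⟩
  refine Submodule.subset_span ⟨x, x', f, ξ, G.pull g x η, ?_⟩
  rw [map_sub, sumPull_tmul, sumPull_tmul, pull_push_apply]

theorem sumPush_rel (c : C) {a a' : C} (f : a ⟶ a') :
    coendRel F G c a ≤ (coendRel F G c a').comap (sumPush F G c f) := by
  refine Submodule.span_le.2 ?_
  rintro _ ⟨x, x', h, ξ, η, rfl⟩
  refine Submodule.subset_span ⟨x, x', h, F.push x' f ξ, η, ?_⟩
  rw [map_sub, sumPush_tmul, sumPush_tmul, pull_push_apply]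

variable {F G} in
theorem coend_hom_ext {c a : C} {M : Type*} [AddCommGroup M] [Module k M]
    {φ ψ : (CoendSum F G c a ⧸ coendRel F G c a) →ₗ[k] M}
    (h : ∀ x (ξ : F.obj x a) (η : G.obj c x),
      φ ((coendRel F G c a).mkQ (coendTmul F G x ξ η)) =
        ψ ((coendRel F G c a).mkQ (coendTmul F G x ξ η))) : φ = ψ := by
  classical
  refine Submodule.linearMap_qext _ (DirectSum.linearMap_ext k fun x => ?_)
  exact TensorProduct.ext' fun ξ η => h x ξ η

theorem coendTmul_add_left {c a : C} (x : C) (ξ ξ' : F.obj x a) (η : G.obj c x) :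
    coendTmul F G x (ξ + ξ') η = coendTmul F G x ξ η + coendTmul F G x ξ' η := by
  simp [coendTmul, TensorProduct.add_tmul]

theorem coendTmul_add_right {c a : C} (x : C) (ξ : F.obj x a) (η η' : G.obj c x) :
    coendTmul F G x ξ (η + η') = coendTmul F G x ξ η + coendTmul F G x ξ η' := by
  simp [coendTmul, TensorProduct.tmul_add]

theorem coendTmul_smul_left {c a : C} (x : C) (t : k) (ξ : F.obj x a) (η : G.obj c x) :
    coendTmul F G x (t • ξ) η = t • coendTmul F G x ξ η := by
  rw [coendTmul, ← TensorProduct.smul_tmul', map_smul, coendTmul]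

theorem coendTmul_smul_right {c a : C} (x : C) (t : k) (ξ : F.obj x a) (η : G.obj c x) :
    coendTmul F G x ξ (t • η) = t • coendTmul F G x ξ η := by
  rw [coendTmul, TensorProduct.tmul_smul, map_smul, coendTmul]

/-- The composite `(c, a) ↦ ∫^x F(x, a) ⊗ G(c, x)` of two linear bifunctors. -/
noncomputable def coend : LinBifunctor.{max u w₁ w₂} k C where
  obj c a := CoendSum F G c a ⧸ coendRel F G c a
  pull {c c'} g a := (coendRel F G c a).mapQ (coendRel F G c' a) (sumPull F G g a)
    (sumPull_rel F G g a)
  push c {a a'} f := (coendRel F G c a).mapQ (coendRel F G c a') (sumPush F G c f)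
    (sumPush_rel F G c f)
  pull_id c a := coend_hom_ext fun x ξ η => by simp [sumPull_tmul, G.pull_id]
  pull_comp g h a := coend_hom_ext fun x ξ η => by simp [sumPull_tmul, G.pull_comp]
  push_id c a := coend_hom_ext fun x ξ η => by simp [sumPush_tmul, F.push_id]
  push_comp c {_ _ _} f h := coend_hom_ext fun x ξ η => by simp [sumPush_tmul, F.push_comp]
  pull_push g f := coend_hom_ext fun x ξ η => by simp [sumPush_tmul, sumPull_tmul]
  pull_add g h a := coend_hom_ext fun x ξ η => by
    simp [sumPull_tmul, G.pull_add, coendTmul_add_right]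
  pull_smul t g a := coend_hom_ext fun x ξ η => by
    simp [sumPull_tmul, G.pull_smul, coendTmul_smul_right]
  push_add c {_ _} f h := coend_hom_ext fun x ξ η => by
    simp [sumPush_tmul, F.push_add, coendTmul_add_left]
  push_smul c {_ _} t f := coend_hom_ext fun x ξ η => by
    simp [sumPush_tmul, F.push_smul, coendTmul_smul_left]

end Coend

/-- The higher extension bifunctors, as coend powers: `E.higher n` is `E^(n+1)`, so that
`E.higher 0` is `E` and `E.higher (n + 1)` sends `(c, a)` to `∫^x E(x, a) ⊗ E^(n+1)(c, x)`. -/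
noncomputable def higher (E : LinBifunctor.{w} k C) : ℕ → LinBifunctor.{max u w} k C
  | 0 => E.ulift
  | n + 1 => E.coend (higher E n)

end LinBifunctor

/-! ## Extriangulated categories -/

/-- The data of an extriangulation on `C`: a linear bifunctor `E` and a realization. `Realizes δ f g`
says that the sequence `a ⟶ b ⟶ c` given by `f` and `g` belongs to the equivalence class `𝔰(δ)`.
The axioms are stated in `ExtData.IsExtriangulated`. -/
structure ExtData (k : Type z) [Field k] (C : Type u) [Category.{v} C] [Preadditive C]
    [Linear k C] extends LinBifunctor.{w, v, u, z} k C where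
  Realizes : ∀ {a b c : C} (_ : obj c a) (_ : a ⟶ b) (_ : b ⟶ c), Prop

namespace ExtData

section Basic

variable {k : Type z} [Field k] {C : Type u} [Category.{v} C] [Preadditive C] [Linear k C]
  (D : ExtData.{w} k C)

/-- The axioms of an extriangulated `k`-category in the sense of Nakaoka and Palu. -/
structure IsExtriangulated : Prop where
  /-- The category `C` is additive. -/
  hasFiniteBiproducts : HasFiniteBiproducts C
  /-- Every extension has a realization. -/
  exists_realizes : ∀ {a c : C} (δ : D.obj c a),
    ∃ (b : C) (f : a ⟶ b) (g : b ⟶ c), D.Realizes δ f g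
  /-- The realizations of an extension form one equivalence class of sequences. -/
  realizes_iff : ∀ {a b b' c : C} {δ : D.obj c a} {f : a ⟶ b} {g : b ⟶ c} (f' : a ⟶ b')
    (g' : b' ⟶ c), D.Realizes δ f g →
      (D.Realizes δ f' g' ↔ ∃ e : b ≅ b', f ≫ e.hom = f' ∧ e.hom ≫ g' = g)
  /-- Morphisms of extensions lift to morphisms of realizations. -/
  lift : ∀ {a b c a' b' c' : C} {δ : D.obj c a} {δ' : D.obj c' a'} {f : a ⟶ b} {g : b ⟶ c}
    {f' : a' ⟶ b'} {g' : b' ⟶ c'} (α : a ⟶ a') (γ : c ⟶ c'), D.Realizes δ f g →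
      D.Realizes δ' f' g' → D.push c α δ = D.pull γ a' δ' →
      ∃ β : b ⟶ b', f ≫ β = α ≫ f' ∧ g ≫ γ = β ≫ g'
  /-- The zero extension is realized by the split sequence. -/
  zero : ∀ {a c : C} (s : BinaryBicone a c), Nonempty s.IsBilimit →
    D.Realizes (0 : D.obj c a) s.inl s.snd
  /-- The realization is compatible with direct sums. -/
  add : ∀ {a b c a' b' c' : C} {δ : D.obj c a} {δ' : D.obj c' a'} {f : a ⟶ b} {g : b ⟶ c}
    {f' : a' ⟶ b'} {g' : b' ⟶ c'} (sa : BinaryBicone a a') (sb : BinaryBicone b b')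
    (sc : BinaryBicone c c'), Nonempty sa.IsBilimit → Nonempty sb.IsBilimit →
      Nonempty sc.IsBilimit → D.Realizes δ f g → D.Realizes δ' f' g' →
      D.Realizes
        (D.push sc.pt sa.inl (D.pull sc.fst a δ) + D.push sc.pt sa.inr (D.pull sc.snd a' δ'))
        (sa.fst ≫ f ≫ sb.inl + sa.snd ≫ f' ≫ sb.inr)
        (sb.fst ≫ g ≫ sc.inl + sb.snd ≫ g' ≫ sc.inr)
  /-- (ET3) -/
  et3 : ∀ {a b c a' b' c' : C} {δ : D.obj c a} {δ' : D.obj c' a'} {f : a ⟶ b} {g : b ⟶ c}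
    {f' : a' ⟶ b'} {g' : b' ⟶ c'} (α : a ⟶ a') (β : b ⟶ b'), D.Realizes δ f g →
      D.Realizes δ' f' g' → f ≫ β = α ≫ f' →
      ∃ γ : c ⟶ c', g ≫ γ = β ≫ g' ∧ D.push c α δ = D.pull γ a' δ'
  /-- (ET3)ᵒᵖ -/
  et3op : ∀ {a b c a' b' c' : C} {δ : D.obj c a} {δ' : D.obj c' a'} {f : a ⟶ b} {g : b ⟶ c}
    {f' : a' ⟶ b'} {g' : b' ⟶ c'} (β : b ⟶ b') (γ : c ⟶ c'), D.Realizes δ f g →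
      D.Realizes δ' f' g' → g ≫ γ = β ≫ g' →
      ∃ α : a ⟶ a', f ≫ β = α ≫ f' ∧ D.push c α δ = D.pull γ a' δ'
  /-- (ET4) -/
  et4 : ∀ {a b c d e : C} {δ : D.obj d a} {δ' : D.obj e b} {f : a ⟶ b} {f' : b ⟶ d}
    {g : b ⟶ c} {g' : c ⟶ e}, D.Realizes δ f f' → D.Realizes δ' g g' →
      ∃ (x : C) (h' : c ⟶ x) (i : d ⟶ x) (p : x ⟶ e) (δ'' : D.obj x a),
        D.Realizes δ'' (f ≫ g) h' ∧ g ≫ h' = f' ≫ i ∧ h' ≫ p = g' ∧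
        D.Realizes (D.push e f' δ') i p ∧ D.pull i a δ'' = δ ∧
        D.push x f δ'' = D.pull p b δ'
  /-- (ET4)ᵒᵖ -/
  et4op : ∀ {a b c d e : C} {δ : D.obj b d} {δ' : D.obj c e} {f' : d ⟶ a} {f : a ⟶ b}
    {g' : e ⟶ b} {g : b ⟶ c}, D.Realizes δ f' f → D.Realizes δ' g' g →
      ∃ (x : C) (h' : x ⟶ a) (i : d ⟶ x) (p : x ⟶ e) (δ'' : D.obj c x),
        D.Realizes δ'' h' (f ≫ g) ∧ h' ≫ f = p ≫ g' ∧ i ≫ h' = f' ∧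
        D.Realizes (D.pull g' d δ) i p ∧ D.push c p δ'' = δ' ∧
        D.push b i δ = D.pull g x δ''

/-- A conflation `a ↣ b ↠ c`. -/
def IsConflation {a b c : C} (f : a ⟶ b) (g : b ⟶ c) : Prop :=
  ∃ δ : D.obj c a, D.Realizes δ f g

def IsInflation {a b : C} (f : a ⟶ b) : Prop :=
  ∃ (c : C) (g : b ⟶ c), D.IsConflation f g

def IsDeflation {b c : C} (g : b ⟶ c) : Prop :=
  ∃ (a : C) (f : a ⟶ b), D.IsConflation f g

/-- The projective objects: `E(x, -) = 0`. -/
def proj : ObjectProperty C := fun x => ∀ (y : C) (δ : D.obj x y), δ = 0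

/-- The injective objects: `E(-, x) = 0`. -/
def inj : ObjectProperty C := fun x => ∀ (y : C) (δ : D.obj y x), δ = 0

/-- The projective-injective objects. -/
def projInj : ObjectProperty C := D.proj ⊓ D.inj

def HasEnoughProjectives : Prop :=
  ∀ x : C, ∃ (q : C) (p : q ⟶ x), D.proj q ∧ D.IsDeflation p

/-- Every functor `E(x, -)` is right exact: for each conflation `a ↣ b ↠ c` the sequence
`E(x, a) → E(x, b) → E(x, c) → 0` is exact. -/
def IsHereditary : Prop :=
  ∀ (x : C) {a b c : C} (f : a ⟶ b) (g : b ⟶ c), D.IsConflation f g →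
    Function.Exact (D.push x f) (D.push x g) ∧ Function.Surjective (D.push x g)

/-- 0-Auslander extriangulated categories. -/
structure IsZeroAuslander : Prop where
  isExtriangulated : D.IsExtriangulated
  enoughProjectives : D.HasEnoughProjectives
  hereditary : D.IsHereditary
  exists_inflation : ∀ p : C, D.proj p →
    ∃ (q : C) (i : p ⟶ q), D.projInj q ∧ D.IsInflation i

/-! ### Rigid subcategories, perpendicular subcategories, Bongartz completions -/

/-- `X^⊥`: the objects `y` with `E^i(x, y) = 0` for all `x` in `X` and all `i > 0`. -/
def rightPerp (X : ObjectProperty C) : ObjectProperty C := fun y =>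
  ∀ (n : ℕ) (x : C), X x → ∀ δ : (D.higher n).obj x y, δ = 0

/-- `^⊥X`: the objects `y` with `E^i(y, x) = 0` for all `x` in `X` and all `i > 0`. -/
def leftPerp (X : ObjectProperty C) : ObjectProperty C := fun y =>
  ∀ (n : ℕ) (x : C), X x → ∀ δ : (D.higher n).obj y x, δ = 0

/-- A rigid (full) subcategory: closed under isomorphisms, and `E^i(r, r') = 0` for all `i ≥ 1`. -/
structure IsRigid (R : ObjectProperty C) : Prop where
  closedUnderIso : R.IsClosedUnderIsomorphisms
  ext_eq_zero : ∀ (n : ℕ) (r r' : C), R r → R r' → ∀ δ : (D.higher n).obj r r', δ = 0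

end Basic

end ExtData

section AddClosure

variable {C : Type u} [Category.{v} C] [Preadditive C]

/-- `add(P)`: the smallest full subcategory containing `P` that is closed under isomorphisms, finite
direct sums (including the empty one) and direct summands. -/
inductive AddClosure (P : ObjectProperty C) : ObjectProperty C
  | of {x : C} : P x → AddClosure P x
  | iso {x y : C} : (x ≅ y) → AddClosure P x → AddClosure P y
  | zero {x : C} : IsZero x → AddClosure P x
  | sum {x y : C} (s : BinaryBicone x y) : s.IsBilimit → AddClosure P x → AddClosure P y →
      AddClosure P s.pt
  | summand {x y : C} (s : BinaryBicone x y) : s.IsBilimit → AddClosure P s.pt → AddClosure P x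

/-- `p : x ⟶ y` is a right `X`-approximation of `y`. -/
def IsRightApprox (X : ObjectProperty C) {x y : C} (p : x ⟶ y) : Prop :=
  X x ∧ ∀ (x' : C), X x' → ∀ f : x' ⟶ y, ∃ g : x' ⟶ x, g ≫ p = f

/-- `i : y ⟶ x` is a left `X`-approximation of `y`. -/
def IsLeftApprox (X : ObjectProperty C) {x y : C} (i : y ⟶ x) : Prop :=
  X x ∧ ∀ (x' : C), X x' → ∀ f : y ⟶ x', ∃ g : x ⟶ x', i ≫ g = f

end AddClosure

namespace ExtData

section Bongartz

variable {k : Type z} [Field k] {C : Type u} [Category.{v} C] [Preadditive C] [Linear k C]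
  (D : ExtData.{w} k C) (R : ObjectProperty C)

/-- `add(R, proj ∩ inj)`. -/
def addProjInj : ObjectProperty C := AddClosure (R ⊔ D.projInj)

/-- The maximal Bongartz completion `R₊`: the smallest additive subcategory containing `R`, the
projective-injective objects, and every `u` in a conflation `u ↣ r' ↠ y` where `y` is injective and
`r' ↠ y` is a right `add(R, proj ∩ inj)`-approximation. -/
def bongartzMax : ObjectProperty C :=
  AddClosure (R ⊔ D.projInj ⊔ fun u => ∃ (r' y : C) (i : u ⟶ r') (p : r' ⟶ y),
    D.inj y ∧ D.IsConflation i p ∧ IsRightApprox (D.addProjInj R) p)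

/-- The minimal Bongartz completion: the smallest additive subcategory containing `R`, the
projective-injective objects, and every `v` in a conflation `x ↣ r' ↠ v` where `x` is projective and
`x ↣ r'` is a left `add(R, proj ∩ inj)`-approximation. -/
def bongartzMin : ObjectProperty C :=
  AddClosure (R ⊔ D.projInj ⊔ fun v => ∃ (r' x : C) (i : x ⟶ r') (p : r' ⟶ v),
    D.proj x ∧ D.IsConflation i p ∧ IsLeftApprox (D.addProjInj R) i)

/-- `R` admits a maximal Bongartz completion. -/
def AdmitsBongartzMax : Prop :=
  ∀ y : C, D.inj y → ∃ (r' : C) (p : r' ⟶ y),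
    D.IsDeflation p ∧ IsRightApprox (D.addProjInj R) p

/-- `R` admits a minimal Bongartz completion. -/
def AdmitsBongartzMin : Prop :=
  ∀ x : C, D.proj x → ∃ (r' : C) (i : x ⟶ r'),
    D.IsInflation i ∧ IsLeftApprox (D.addProjInj R) i

/-- `R` admits Bongartz completions. -/
def AdmitsBongartz : Prop := D.AdmitsBongartzMax R ∧ D.AdmitsBongartzMin R

end Bongartz

/-! ### The restriction to a full subcategory, and `Z_R` -/

section Restrict

variable {k : Type z} [Field k] {C : Type u} [Category.{v} C] [Preadditive C] [Linear k C]
  (D : ExtData.{w} k C)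

/-- The restriction of `(E, 𝔰)` to a full subcategory. -/
def restrict (P : ObjectProperty C) : ExtData.{w} k P.FullSubcategory where
  obj c a := D.obj c.obj a.obj
  pull g a := D.pull g.hom a.obj
  push c {_ _} f := D.push c.obj f.hom
  pull_id c a := D.pull_id c.obj a.obj
  pull_comp g h a := D.pull_comp g.hom h.hom a.obj
  push_id c a := D.push_id c.obj a.obj
  push_comp c {_ _ _} f h := D.push_comp c.obj f.hom h.hom
  pull_push g f := D.pull_push g.hom f.hom
  pull_add g h a := D.pull_add g.hom h.hom a.obj
  pull_smul t g a := D.pull_smul t g.hom a.obj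
  push_add c {_ _} f h := D.push_add c.obj f.hom h.hom
  push_smul c {_ _} t f := D.push_smul c.obj t f.hom
  Realizes δ f g := D.Realizes δ f.hom g.hom

/-- The objects of `Z_R = R^⊥ ∩ ^⊥R`. -/
def zProp (R : ObjectProperty C) : ObjectProperty C := D.rightPerp R ⊓ D.leftPerp R

/-- The category `Z_R`. -/
abbrev ZCat (R : ObjectProperty C) : Type u := (D.zProp R).FullSubcategory

/-- The structure that `Z_R` inherits from `C`. -/
def onZ (R : ObjectProperty C) : ExtData.{w} k (D.ZCat R) := D.restrict (D.zProp R)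

end Restrict

end ExtData

/-! ### Ideal quotients -/

section IdealQuotient

variable (k : Type z) [Field k] {C : Type u} [Category.{v} C] [Preadditive C] [Linear k C]
  (R : ObjectProperty C)

/-- The two-sided ideal `[R]` generated by the morphisms that factor through an object in `R`. (It
consists of these morphisms only, as soon as `R` is closed under finite direct sums.) -/
def factorIdeal (x y : C) : Submodule k (x ⟶ y) :=
  Submodule.span k {f | ∃ (r : C) (g : x ⟶ r) (h : r ⟶ y), R r ∧ f = g ≫ h}

theorem factorIdeal_comp_left {x y y' : C} (h : x ⟶ y) {f : y ⟶ y'}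
    (hf : f ∈ factorIdeal k R y y') : h ≫ f ∈ factorIdeal k R x y' := by
  have : factorIdeal k R y y' ≤ (factorIdeal k R x y').comap (Linear.leftComp k y' h) := by
    refine Submodule.span_le.2 ?_
    rintro _ ⟨r, g, g', hr, rfl⟩
    exact Submodule.subset_span ⟨r, h ≫ g, g', hr, by simp⟩
  exact this hf

theorem factorIdeal_comp_right {x y y' : C} {f : x ⟶ y} (h : y ⟶ y')
    (hf : f ∈ factorIdeal k R x y) : f ≫ h ∈ factorIdeal k R x y' := by
  have : factorIdeal k R x y ≤ (factorIdeal k R x y').comap (Linear.rightComp k x h) := by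
    refine Submodule.span_le.2 ?_
    rintro _ ⟨r, g, g', hr, rfl⟩
    exact Submodule.subset_span ⟨r, g, g' ≫ h, hr, by simp⟩
  exact this hf

/-- Two parallel morphisms are identified if their difference lies in `[R]`. -/
def idealRel : HomRel C := fun x y f g => f - g ∈ factorIdeal k R x y

instance idealRel_congruence : Congruence (idealRel k R) where
  equivalence :=
    { refl := fun f => by simp [idealRel]
      symm := fun {f g} h => by
        have := (factorIdeal k R _ _).neg_mem h
        rwa [neg_sub] at this
      trans := fun {f g h} h₁ h₂ => by
        have := (factorIdeal k R _ _).add_mem h₁ h₂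
        rwa [sub_add_sub_cancel] at this }
  comp_left f g g' h := by
    have := factorIdeal_comp_left k R f h
    rwa [Preadditive.comp_sub] at this
  comp_right g h := by
    have := factorIdeal_comp_right k R g h
    rwa [Preadditive.sub_comp] at this

/-- The ideal quotient `C / [R]`. -/
abbrev IdealQuotient : Type u := CategoryTheory.Quotient (idealRel k R)

theorem idealRel_add ⦃x y : C⦄ (f₁ f₂ g₁ g₂ : x ⟶ y) (hf : idealRel k R f₁ f₂)
    (hg : idealRel k R g₁ g₂) : idealRel k R (f₁ + g₁) (f₂ + g₂) := by
  have := (factorIdeal k R _ _).add_mem hf hg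
  rwa [← add_sub_add_comm] at this

theorem idealRel_smul (t : k) ⦃x y : C⦄ (f₁ f₂ : x ⟶ y) (hf : idealRel k R f₁ f₂) :
    idealRel k R (t • f₁) (t • f₂) := by
  have := (factorIdeal k R _ _).smul_mem t hf
  rwa [smul_sub] at this

instance idealQuotientPreadditive : Preadditive (IdealQuotient k R) :=
  CategoryTheory.Quotient.preadditive _ (idealRel_add k R)

instance idealQuotientFunctor_additive :
    (CategoryTheory.Quotient.functor (idealRel k R)).Additive :=
  CategoryTheory.Quotient.functor_additive _ (idealRel_add k R)

instance idealQuotientLinear : Linear k (IdealQuotient k R) :=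
  CategoryTheory.Quotient.linear k _ (idealRel_smul k R)

end IdealQuotient

namespace ExtData

section Quotient

variable {k : Type z} [Field k] {C : Type u} [Category.{v} C] [Preadditive C] [Linear k C]
  (D : ExtData.{w} k C) (R : ObjectProperty C)

variable {D R} in
theorem pull_eq_of_idealRel (hR : R ≤ D.projInj) {c c' : C} {g h : c' ⟶ c}
    (e : idealRel k R g h) (a : C) : D.pull g a = D.pull h a := by
  have key : ∀ f ∈ factorIdeal k R c' c, D.pull f a = 0 := by
    intro f hf
    induction hf using Submodule.span_induction with
    | mem f hf =>
      obtain ⟨r, p, q, hr, rfl⟩ := hf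
      ext δ
      rw [D.pull_comp, LinearMap.comp_apply, (hR r hr).1 a (D.pull q a δ)]
      simp
    | zero => simpa using D.pull_smul (0 : k) (0 : c' ⟶ c) a
    | add f f' _ _ h h' => rw [D.pull_add, h, h', add_zero]
    | smul t f _ h => rw [D.pull_smul, h, smul_zero]
  have := D.pull_add (g - h) h a
  rwa [sub_add_cancel, key _ e, zero_add] at this

variable {D R} in
theorem push_eq_of_idealRel (hR : R ≤ D.projInj) (c : C) {a a' : C} {f h : a ⟶ a'}
    (e : idealRel k R f h) : D.push c f = D.push c h := by
  have key : ∀ f ∈ factorIdeal k R a a', D.push c f = 0 := by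
    intro f hf
    induction hf using Submodule.span_induction with
    | mem f hf =>
      obtain ⟨r, p, q, hr, rfl⟩ := hf
      ext δ
      rw [D.push_comp, LinearMap.comp_apply, (hR r hr).2 c (D.push c p δ)]
      simp
    | zero => simpa using D.push_smul c (0 : k) (0 : a ⟶ a')
    | add f f' _ _ h h' => rw [D.push_add, h, h', add_zero]
    | smul t f _ h => rw [D.push_smul, h, smul_zero]
  have := D.push_add c (f - h) h
  rwa [sub_add_cancel, key _ e, zero_add] at this

/-- The structure induced on the ideal quotient `C / [R]` when `R` consists of projective-injective
objects: the modules are `E(c, a)`, on which morphisms act through representatives, and `δ` is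
realized by the sequences isomorphic (with fixed ends) to the image of a realization of `δ`
in `C`. -/
def quotient (hR : R ≤ D.projInj) : ExtData.{w} k (IdealQuotient k R) where
  obj c a := D.obj c.as a.as
  pull {c c'} g a := Quot.lift (fun f : c'.as ⟶ c.as => D.pull f a.as)
    (fun _ _ h => pull_eq_of_idealRel hR ((HomRel.compClosure_iff_self _ _ _).1 h) a.as) g
  push c {a a'} g := Quot.lift (fun f : a.as ⟶ a'.as => D.push c.as f)
    (fun _ _ h => push_eq_of_idealRel hR c.as ((HomRel.compClosure_iff_self _ _ _).1 h)) g
  pull_id c a := D.pull_id c.as a.as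
  pull_comp := by rintro _ _ _ ⟨g⟩ ⟨h⟩ a; exact D.pull_comp g h a.as
  push_id c a := D.push_id c.as a.as
  push_comp := by rintro c _ _ _ ⟨f⟩ ⟨h⟩; exact D.push_comp c.as f h
  pull_push := by rintro _ _ _ _ ⟨g⟩ ⟨f⟩; exact D.pull_push g f
  pull_add := by rintro _ _ ⟨g⟩ ⟨h⟩ a; exact D.pull_add g h a.as
  pull_smul := by rintro _ _ t ⟨g⟩ a; exact D.pull_smul t g a.as
  push_add := by rintro c _ _ ⟨f⟩ ⟨h⟩; exact D.push_add c.as f h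
  push_smul := by rintro c _ _ t ⟨f⟩; exact D.push_smul c.as t f
  Realizes {a b c} δ f g := ∃ (b₀ : C) (f₀ : a.as ⟶ b₀) (g₀ : b₀ ⟶ c.as)
    (e : (CategoryTheory.Quotient.functor (idealRel k R)).obj b₀ ≅ b),
    D.Realizes δ f₀ g₀ ∧
    (CategoryTheory.Quotient.functor (idealRel k R)).map f₀ ≫ e.hom = f ∧
    e.hom ≫ g = (CategoryTheory.Quotient.functor (idealRel k R)).map g₀

/-- `R`, regarded as a full subcategory of `Z_R`. -/
def inZ : ObjectProperty (D.ZCat R) := R.inverseImage (D.zProp R).ι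

theorem inZ_le_projInj : D.inZ R ≤ (D.onZ R).projInj := by
  intro r hr
  refine ⟨fun y δ => ?_, fun y δ => ?_⟩
  · exact congrArg ULift.down (y.property.1 0 r.obj hr (ULift.up.{u} (α := D.obj _ _) δ))
  · exact congrArg ULift.down (y.property.2 0 r.obj hr (ULift.up.{u} (α := D.obj _ _) δ))

/-- The reduced category `Z_R / [R]`. -/
abbrev ReducedCat : Type u := IdealQuotient k (D.inZ R)

/-- The structure that `Z_R / [R]` inherits from `Z_R`. -/
def reduced : ExtData.{w} k (D.ReducedCat R) := (D.onZ R).quotient (D.inZ R) (D.inZ_le_projInj R)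

/-- The image of a full subcategory `Q` in the reduced category: the objects isomorphic there to an
object of `Q` lying in `Z_R`. -/
def reducedImage (Q : ObjectProperty C) : ObjectProperty (D.ReducedCat R) :=
  (Q.inverseImage (D.zProp R).ι).map (CategoryTheory.Quotient.functor (idealRel k (D.inZ R)))

end Quotient

end ExtData

/-! Heredity makes `E(-, x)` right exact too (`IsHereditary.op`) and kills `E^i` for `i ≥ 2`
(`IsHereditary.higher_succ_eq_zero`). Hence both perpendicular subcategories are governed by `E`
alone (`rightOrth`, `leftOrth`), and half exactness makes `Z_R` closed under extensions. By
construction `R` is projective-injective in `Z_R`, and dividing out projective-injective objects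
preserves the axioms (`quotient_isExtriangulated`).

The 0-Auslander condition is self-dual (`IsZeroAuslander.op`), so statements about injectives and
`R₋` mostly follow from those about projectives and `R₊`. Write `A` for `add(R, proj ∩ inj)`, and
let `u ↣ r' ↠ y` be a right `A`-approximation of an injective `y`. The approximation property gives
`E(R, u) = 0`. Since `E(r', x) → E(u, x)` is onto, `E(u, x) = 0` for every `x` in `R^⊥`. So `R₊`
lies in `Z_R`, consists of projectives there, and has the same right perpendicular category as `R`.

Two constructions do the rest. `exists_approxKernel_resolution` pulls an approximation of `y` back
along an injective coresolution `x ↣ y ↠ y'` of an object of `R^⊥`, giving `u ↣ w ↠ x` with `u` and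
`w` kernels of approximations. Thus `Z_R` has enough projectives, and a projective of `Z_R` is a
summand of such a `w`. `exists_inflation_of_approxKernel` embeds a kernel of an approximation into
an object of `A`, with cokernel in `Z_R`; the objects of `A` are projective-injective in `Z_R`. This
makes `Z_R` 0-Auslander, and the quotient inherits it.

For a larger rigid `Q`, both constructions are applied to `Q`. If `E(^⊥R, y) = 0`, as for the
injectives of `Z_R`, the resulting cokernel splits off and leaves a right approximation of `y` with
kernel in `Z_R` (`exists_rightApprox`). It remains an approximation in the quotient, because
projective-injectives of `Z_R` lie in `A` (`addProjInj_of_onZ_projInj`). -/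

namespace LinBifunctor

/-! ### Linear bifunctors on elements -/

variable {k : Type z} [Field k] {C : Type u} [Category.{v} C] [Preadditive C] [Linear k C]
  (E : LinBifunctor.{w} k C)

theorem pull_id_apply {c a : C} (δ : E.obj c a) : E.pull (𝟙 c) a δ = δ := by
  rw [E.pull_id]; rfl

theorem push_id_apply {c a : C} (δ : E.obj c a) : E.push c (𝟙 a) δ = δ := by
  rw [E.push_id]; rfl

theorem pull_comp_apply {c c' c'' : C} (g : c'' ⟶ c') (h : c' ⟶ c) {a : C} (δ : E.obj c a) :
    E.pull (g ≫ h) a δ = E.pull g a (E.pull h a δ) := by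
  rw [E.pull_comp]; rfl

theorem push_comp_apply {c a a' a'' : C} (f : a ⟶ a') (h : a' ⟶ a'') (δ : E.obj c a) :
    E.push c (f ≫ h) δ = E.push c h (E.push c f δ) := by
  rw [E.push_comp]; rfl

theorem pull_add_apply {c c' a : C} (g h : c' ⟶ c) (δ : E.obj c a) :
    E.pull (g + h) a δ = E.pull g a δ + E.pull h a δ := by
  rw [E.pull_add]; rfl

theorem push_add_apply {c a a' : C} (f h : a ⟶ a') (δ : E.obj c a) :
    E.push c (f + h) δ = E.push c f δ + E.push c h δ := by
  rw [E.push_add]; rfl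

theorem pull_zero {c c' a : C} (δ : E.obj c a) : E.pull (0 : c' ⟶ c) a δ = 0 := by
  rw [← zero_smul k (0 : c' ⟶ c), E.pull_smul, zero_smul]; rfl

theorem push_zero {c a a' : C} (δ : E.obj c a) : E.push c (0 : a ⟶ a') δ = 0 := by
  rw [← zero_smul k (0 : a ⟶ a'), E.push_smul, zero_smul]; rfl

theorem eq_zero_of_isZero_left {c a : C} (hc : IsZero c) (δ : E.obj c a) : δ = 0 := by
  rw [← E.pull_id_apply δ, hc.eq_of_src (𝟙 c) 0, E.pull_zero]

theorem eq_zero_of_isZero_right {c a : C} (ha : IsZero a) (δ : E.obj c a) : δ = 0 := by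
  rw [← E.push_id_apply δ, ha.eq_of_src (𝟙 a) 0, E.push_zero]

theorem eq_zero_of_push_iso {c a a' : C} (e : a ≅ a') (δ : E.obj c a)
    (h : E.push c e.hom δ = 0) : δ = 0 := by
  rw [← E.push_id_apply δ, ← e.hom_inv_id, E.push_comp_apply, h, map_zero]

theorem eq_zero_of_pull_iso {c c' a : C} (e : c' ≅ c) (δ : E.obj c a)
    (h : E.pull e.hom a δ = 0) : δ = 0 := by
  rw [← E.pull_id_apply δ, ← e.inv_hom_id, E.pull_comp_apply, h, map_zero]

end LinBifunctor

/-! ### Explicit biproducts -/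

section Bicones

variable {C : Type u} [Category.{v} C] [Preadditive C]

theorem binaryBicone_total {x y : C} {s : BinaryBicone x y} (hs : Nonempty s.IsBilimit) :
    s.fst ≫ s.inl + s.snd ≫ s.inr = 𝟙 s.pt :=
  IsBilimit.binary_total hs.some

/-- The bicone with zero second summand. -/
def biconeZeroRight (a : C) {o : C} (ho : IsZero o) : BinaryBicone a o where
  pt := a
  fst := 𝟙 a
  snd := 0
  inl := 𝟙 a
  inr := 0
  inr_snd := ho.eq_of_src _ _

theorem biconeZeroRight_isBilimit (a : C) {o : C} (ho : IsZero o) :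
    Nonempty (biconeZeroRight a ho).IsBilimit :=
  ⟨isBinaryBilimitOfTotal _ (by
    simp only [biconeZeroRight, Category.comp_id, comp_zero]
    exact add_zero _)⟩

/-- The bicone with the two summands exchanged. -/
def biconeSwap {x y : C} (s : BinaryBicone x y) : BinaryBicone y x where
  pt := s.pt
  fst := s.snd
  snd := s.fst
  inl := s.inr
  inr := s.inl

theorem biconeSwap_isBilimit {x y : C} {s : BinaryBicone x y} (hs : Nonempty s.IsBilimit) :
    Nonempty (biconeSwap s).IsBilimit :=
  ⟨isBinaryBilimitOfTotal _ (by
    have := binaryBicone_total hs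
    rw [add_comm] at this
    exact this)⟩

/-- Biproducts of isomorphic objects are isomorphic. -/
def biconeIso {x y x' y' : C} {s : BinaryBicone x y} {t : BinaryBicone x' y'} (e : x ≅ x')
    (e' : y ≅ y') (hs : Nonempty s.IsBilimit) (ht : Nonempty t.IsBilimit) : s.pt ≅ t.pt where
  hom := s.fst ≫ e.hom ≫ t.inl + s.snd ≫ e'.hom ≫ t.inr
  inv := t.fst ≫ e.inv ≫ s.inl + t.snd ≫ e'.inv ≫ s.inr
  hom_inv_id := by simp [binaryBicone_total hs]
  inv_hom_id := by simp [binaryBicone_total ht]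

section

variable {x y x' y' : C} {s : BinaryBicone x y} {t : BinaryBicone x' y'} (e : x ≅ x')
    (e' : y ≅ y') (hs : Nonempty s.IsBilimit) (ht : Nonempty t.IsBilimit)

theorem inl_biconeIso_hom : s.inl ≫ (biconeIso e e' hs ht).hom = e.hom ≫ t.inl := by
  simp [biconeIso]

theorem inr_biconeIso_hom : s.inr ≫ (biconeIso e e' hs ht).hom = e'.hom ≫ t.inr := by
  simp [biconeIso]

theorem biconeIso_hom_fst : (biconeIso e e' hs ht).hom ≫ t.fst = s.fst ≫ e.hom := by
  simp [biconeIso]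

theorem biconeIso_hom_snd : (biconeIso e e' hs ht).hom ≫ t.snd = s.snd ≫ e'.hom := by
  simp [biconeIso]

end

theorem biconeMap_comp_biconeIso {x y x' y' u v u' v' : C} {s : BinaryBicone x y}
    {s' : BinaryBicone x' y'} {t : BinaryBicone u v} {t' : BinaryBicone u' v'} (e : x ≅ x')
    (e' : y ≅ y') (hs : Nonempty s.IsBilimit) (hs' : Nonempty s'.IsBilimit) (ε : u ≅ u')
    (ε' : v ≅ v') (ht : Nonempty t.IsBilimit) (ht' : Nonempty t'.IsBilimit) {f : x ⟶ u} {g : y ⟶ v}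
    {f' : x' ⟶ u'} {g' : y' ⟶ v'} (h₁ : f ≫ ε.hom = e.hom ≫ f') (h₂ : g ≫ ε'.hom = e'.hom ≫ g') :
    (s.fst ≫ f ≫ t.inl + s.snd ≫ g ≫ t.inr) ≫ (biconeIso ε ε' ht ht').hom =
      (biconeIso e e' hs hs').hom ≫ (s'.fst ≫ f' ≫ t'.inl + s'.snd ≫ g' ≫ t'.inr) := by
  rw [Preadditive.comp_add, ← Category.assoc _ s'.fst, ← Category.assoc _ s'.snd,
    biconeIso_hom_fst, biconeIso_hom_snd]
  simp only [Preadditive.add_comp, Category.assoc, inl_biconeIso_hom, inr_biconeIso_hom,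
    reassoc_of% h₁, reassoc_of% h₂]

end Bicones

/-! ### Exactness properties that follow from the axioms without (ET4) -/

namespace ExtData

variable {k : Type z} [Field k] {C : Type u} [Category.{v} C] [Preadditive C] [Linear k C]
  (D : ExtData.{w} k C)

/-- The axioms of an extriangulated category other than the compatibility of the realization with
direct sums and (ET4), (ET4)ᵒᵖ. -/
structure IsPreExtriangulated : Prop where
  exists_isZero : ∃ o : C, IsZero o
  exists_realizes : ∀ {a c : C} (δ : D.obj c a),
    ∃ (b : C) (f : a ⟶ b) (g : b ⟶ c), D.Realizes δ f g
  realizes_iff : ∀ {a b b' c : C} {δ : D.obj c a} {f : a ⟶ b} {g : b ⟶ c} (f' : a ⟶ b')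
    (g' : b' ⟶ c), D.Realizes δ f g →
      (D.Realizes δ f' g' ↔ ∃ e : b ≅ b', f ≫ e.hom = f' ∧ e.hom ≫ g' = g)
  lift : ∀ {a b c a' b' c' : C} {δ : D.obj c a} {δ' : D.obj c' a'} {f : a ⟶ b} {g : b ⟶ c}
    {f' : a' ⟶ b'} {g' : b' ⟶ c'} (α : a ⟶ a') (γ : c ⟶ c'), D.Realizes δ f g →
      D.Realizes δ' f' g' → D.push c α δ = D.pull γ a' δ' →
      ∃ β : b ⟶ b', f ≫ β = α ≫ f' ∧ g ≫ γ = β ≫ g'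
  zero : ∀ {a c : C} (s : BinaryBicone a c), Nonempty s.IsBilimit →
    D.Realizes (0 : D.obj c a) s.inl s.snd
  et3 : ∀ {a b c a' b' c' : C} {δ : D.obj c a} {δ' : D.obj c' a'} {f : a ⟶ b} {g : b ⟶ c}
    {f' : a' ⟶ b'} {g' : b' ⟶ c'} (α : a ⟶ a') (β : b ⟶ b'), D.Realizes δ f g →
      D.Realizes δ' f' g' → f ≫ β = α ≫ f' →
      ∃ γ : c ⟶ c', g ≫ γ = β ≫ g' ∧ D.push c α δ = D.pull γ a' δ'
  et3op : ∀ {a b c a' b' c' : C} {δ : D.obj c a} {δ' : D.obj c' a'} {f : a ⟶ b} {g : b ⟶ c}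
    {f' : a' ⟶ b'} {g' : b' ⟶ c'} (β : b ⟶ b') (γ : c ⟶ c'), D.Realizes δ f g →
      D.Realizes δ' f' g' → g ≫ γ = β ≫ g' →
      ∃ α : a ⟶ a', f ≫ β = α ≫ f' ∧ D.push c α δ = D.pull γ a' δ'

variable {D}

theorem IsExtriangulated.toPre (hD : D.IsExtriangulated) : D.IsPreExtriangulated where
  exists_isZero := by
    have := hD.hasFiniteBiproducts
    exact ⟨⊤_ C, IsZero.of_iso (isZero_zero C) (HasZeroObject.zeroIsoTerminal.symm)⟩
  exists_realizes := hD.exists_realizes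
  realizes_iff := hD.realizes_iff
  lift := hD.lift
  zero := hD.zero
  et3 := hD.et3
  et3op := hD.et3op

namespace IsPreExtriangulated

variable (hD : D.IsPreExtriangulated)
include hD

theorem realizes_id_zero (a : C) {o : C} (ho : IsZero o) :
    D.Realizes (0 : D.obj o a) (𝟙 a) (0 : a ⟶ o) :=
  hD.zero (biconeZeroRight a ho) (biconeZeroRight_isBilimit a ho)

theorem realizes_zero_id (c : C) {o : C} (ho : IsZero o) :
    D.Realizes (0 : D.obj c o) (0 : o ⟶ c) (𝟙 c) :=
  hD.zero (biconeSwap (biconeZeroRight c ho))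
    (biconeSwap_isBilimit (biconeZeroRight_isBilimit c ho))

section

variable {a b c : C} {δ : D.obj c a} {f : a ⟶ b} {g : b ⟶ c} (h : D.Realizes δ f g)
include h

/-- Comparing a realization with a split sequence having a zero end turns each axiom into one
exactness statement; this lemma and the following ones up to `exists_desc_cokernel` arise in this
way. -/
theorem comp_eq_zero : f ≫ g = 0 := by
  obtain ⟨o, ho⟩ := hD.exists_isZero
  obtain ⟨γ, hγ, -⟩ := hD.et3 (𝟙 a) f (hD.realizes_id_zero a ho) h rfl
  rw [← hγ, zero_comp]

theorem pull_self : D.pull g a δ = 0 := by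
  obtain ⟨o, ho⟩ := hD.exists_isZero
  obtain ⟨α, -, hα⟩ := hD.et3op (𝟙 b) g (hD.realizes_zero_id b ho) h rfl
  rw [← hα, map_zero]

theorem push_self : D.push c f δ = 0 := by
  obtain ⟨o, ho⟩ := hD.exists_isZero
  obtain ⟨γ, -, hγ⟩ := hD.et3 f (𝟙 b) h (hD.realizes_id_zero b ho) rfl
  rw [hγ, map_zero]

theorem exists_lift {x : C} (t : x ⟶ c) (ht : D.pull t a δ = 0) : ∃ t' : x ⟶ b, t' ≫ g = t := by
  obtain ⟨o, ho⟩ := hD.exists_isZero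
  obtain ⟨β, -, hβ⟩ := hD.lift (0 : o ⟶ a) t (hD.realizes_zero_id x ho) h (by simp [ht])
  exact ⟨β, by simpa using hβ.symm⟩

theorem exists_desc {y : C} (t : a ⟶ y) (ht : D.push c t δ = 0) : ∃ t' : b ⟶ y, f ≫ t' = t := by
  obtain ⟨o, ho⟩ := hD.exists_isZero
  obtain ⟨β, hβ, -⟩ := hD.lift t (0 : c ⟶ o) h (hD.realizes_id_zero y ho) (by simp [ht])
  exact ⟨β, by simpa using hβ⟩

theorem exists_lift_kernel {x : C} (t : x ⟶ b) (ht : t ≫ g = 0) : ∃ t' : x ⟶ a, t' ≫ f = t := by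
  obtain ⟨o, ho⟩ := hD.exists_isZero
  obtain ⟨α, hα, -⟩ := hD.et3op t (0 : o ⟶ c) (hD.realizes_id_zero x ho) h (by simp [ht])
  exact ⟨α, by simpa using hα.symm⟩

theorem exists_desc_cokernel {y : C} (t : b ⟶ y) (ht : f ≫ t = 0) :
    ∃ t' : c ⟶ y, g ≫ t' = t := by
  obtain ⟨o, ho⟩ := hD.exists_isZero
  obtain ⟨γ, hγ, -⟩ := hD.et3 (0 : a ⟶ o) t h (hD.realizes_zero_id y ho) (by simp [ht])
  exact ⟨γ, by simpa using hγ⟩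

/-- The vanishing of `f_* η` extends `f` over the middle term of a realization of `η`; (ET3) with
the identity on `a` then produces the map to `c`. -/
theorem exists_pull_eq {x : C} (η : D.obj x a) (hη : D.push x f η = 0) :
    ∃ t : x ⟶ c, η = D.pull t a δ := by
  obtain ⟨e, f', g', h'⟩ := hD.exists_realizes η
  obtain ⟨β, hβ⟩ := hD.exists_desc h' f hη
  obtain ⟨γ, -, hγ⟩ := hD.et3 (𝟙 a) β h' h (by simp [hβ])
  exact ⟨γ, by rw [← hγ, D.push_id_apply]⟩

theorem exists_push_eq {y : C} (η : D.obj c y) (hη : D.pull g y η = 0) :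
    ∃ t : a ⟶ y, η = D.push c t δ := by
  obtain ⟨e, f', g', h'⟩ := hD.exists_realizes η
  obtain ⟨β, hβ⟩ := hD.exists_lift h' g hη
  obtain ⟨α, -, hα⟩ := hD.et3op β (𝟙 c) h h' (by simp [hβ])
  exact ⟨α, by rw [hα, D.pull_id_apply]⟩

end

/-- A morphism of realizations whose end terms are isomorphisms is an isomorphism. -/
theorem isIso_of_ends {a b c a' b' c' : C} {δ : D.obj c a} {δ' : D.obj c' a'} {f : a ⟶ b}
    {g : b ⟶ c} {f' : a' ⟶ b'} {g' : b' ⟶ c'} (h : D.Realizes δ f g) (h' : D.Realizes δ' f' g')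
    (α : a ≅ a') (γ : c ≅ c') (β : b ⟶ b') (hδ : D.push c α.hom δ = D.pull γ.hom a' δ')
    (h₁ : f ≫ β = α.hom ≫ f') (h₂ : g ≫ γ.hom = β ≫ g') : IsIso β := by
  -- This vanishing lifts `g' ≫ γ.inv` to `σ : b' ⟶ b`. The error `𝟙 - σ ≫ β` dies in `c'`, so it
  -- factors through `f'` as `τ ≫ f'`, and `τ ≫ α.inv ≫ f` corrects `σ` to a one-sided inverse. The
  -- primed maps give the inverse on the other side.
  have hδ₁ : D.pull (g' ≫ γ.inv) a δ = 0 := by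
    refine D.eq_zero_of_push_iso α _ ?_
    rw [← D.pull_push_apply, hδ, ← D.pull_comp_apply]
    simpa using hD.pull_self h'
  have hδ₂ : D.push c' (α.inv ≫ f) δ' = 0 := by
    refine D.eq_zero_of_pull_iso γ _ ?_
    rw [D.pull_push_apply, ← hδ, ← D.push_comp_apply]
    simpa using hD.push_self h
  obtain ⟨σ, hσ⟩ := hD.exists_lift h _ hδ₁
  obtain ⟨τ, hτ⟩ := hD.exists_lift_kernel h' (𝟙 b' - σ ≫ β) (by
    simp only [Preadditive.sub_comp, Category.id_comp, Category.assoc, ← h₂]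
    rw [reassoc_of% hσ]; simp)
  obtain ⟨σ', hσ'⟩ := hD.exists_desc h' _ hδ₂
  obtain ⟨τ', hτ'⟩ := hD.exists_desc_cokernel h (𝟙 b - β ≫ σ') (by
    simp only [Preadditive.comp_sub, Category.comp_id, reassoc_of% h₁, hσ']; simp)
  have e₁ : (σ + τ ≫ α.inv ≫ f) ≫ β = 𝟙 b' := by
    simp [h₁, hτ]
  have e₂ : β ≫ (σ' + g' ≫ γ.inv ≫ τ') = 𝟙 b := by
    rw [Preadditive.comp_add, ← reassoc_of% h₂]
    simp [hτ']
  refine ⟨σ + τ ≫ α.inv ≫ f, ?_, e₁⟩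
  have : σ + τ ≫ α.inv ≫ f = σ' + g' ≫ γ.inv ≫ τ' := by
    rw [← Category.comp_id (σ + _), ← e₂, ← Category.assoc, e₁, Category.id_comp]
  rw [this, e₂]

theorem realizes_of_iso {a b b' c : C} {δ : D.obj c a} {f : a ⟶ b} {g : b ⟶ c}
    (h : D.Realizes δ f g) (e : b ≅ b') : D.Realizes δ (f ≫ e.hom) (e.inv ≫ g) :=
  (hD.realizes_iff _ _ h).2 ⟨e, by simp⟩

/-- Realizations may be transported along isomorphisms of all three terms. -/
theorem realizes_of_isos {a b c a' b' c' : C} {δ : D.obj c a} {δ' : D.obj c' a'} {f : a ⟶ b}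
    {g : b ⟶ c} {f' : a' ⟶ b'} {g' : b' ⟶ c'} (h : D.Realizes δ f g) (α : a ≅ a') (β : b ≅ b')
    (γ : c ≅ c') (hδ : D.push c α.hom δ = D.pull γ.hom a' δ')
    (h₁ : f ≫ β.hom = α.hom ≫ f') (h₂ : g ≫ γ.hom = β.hom ≫ g') : D.Realizes δ' f' g' := by
  obtain ⟨m, p, q, hm⟩ := hD.exists_realizes δ'
  obtain ⟨β', h₁', h₂'⟩ := hD.lift α.hom γ.hom h hm hδ
  have := hD.isIso_of_ends h hm α γ β' hδ h₁' h₂'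
  refine (hD.realizes_iff _ _ hm).2 ⟨(asIso β').symm ≪≫ β, ?_, ?_⟩
  · have : p = α.inv ≫ f ≫ β' := by simp [h₁']
    simp [this, h₁]
  · simp [← h₂, h₂']

end IsPreExtriangulated

end ExtData

/-! ### Passage to the opposite category -/

section Opposite

open Opposite

variable {k : Type z} [Field k] {C : Type u} [Category.{v} C] [Preadditive C] [Linear k C]

instance homModuleOp (X Y : Cᵒᵖ) : Module k (X ⟶ Y) where
  smul t f := (t • f.unop).op
  one_smul f := Quiver.Hom.unop_inj (one_smul k f.unop)
  mul_smul s t f := Quiver.Hom.unop_inj (mul_smul s t f.unop)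
  smul_zero t := Quiver.Hom.unop_inj (smul_zero t)
  smul_add t f g := Quiver.Hom.unop_inj (smul_add t f.unop g.unop)
  add_smul s t f := Quiver.Hom.unop_inj (add_smul s t f.unop)
  zero_smul f := Quiver.Hom.unop_inj (zero_smul k f.unop)

instance linearOp : Linear k Cᵒᵖ where
  smul_comp _ _ _ t f g := by
    refine Quiver.Hom.unop_inj ?_
    exact Linear.comp_smul _ _ _ g.unop t f.unop
  comp_smul _ _ _ f t g := by
    refine Quiver.Hom.unop_inj ?_
    exact Linear.smul_comp _ _ _ t g.unop f.unop

/-- The opposite bicone. -/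
def biconeUnop {x y : Cᵒᵖ} (s : BinaryBicone x y) : BinaryBicone x.unop y.unop where
  pt := s.pt.unop
  fst := s.inl.unop
  snd := s.inr.unop
  inl := s.fst.unop
  inr := s.snd.unop
  inl_fst := by rw [← unop_comp, s.inl_fst]; rfl
  inl_snd := by rw [← unop_comp, s.inr_fst]; rfl
  inr_fst := by rw [← unop_comp, s.inl_snd]; rfl
  inr_snd := by rw [← unop_comp, s.inr_snd]; rfl

theorem biconeUnop_isBilimit {x y : Cᵒᵖ} {s : BinaryBicone x y} (hs : Nonempty s.IsBilimit) :
    Nonempty (biconeUnop s).IsBilimit :=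
  ⟨isBinaryBilimitOfTotal _ (congrArg Quiver.Hom.unop (binaryBicone_total hs))⟩

/-- The opposite bicone. -/
def biconeOp {x y : C} (s : BinaryBicone x y) : BinaryBicone (op x) (op y) where
  pt := op s.pt
  fst := s.inl.op
  snd := s.inr.op
  inl := s.fst.op
  inr := s.snd.op
  inl_fst := by rw [← op_comp, s.inl_fst]; rfl
  inl_snd := by rw [← op_comp, s.inr_fst]; rfl
  inr_fst := by rw [← op_comp, s.inl_snd]; rfl
  inr_snd := by rw [← op_comp, s.inr_snd]; rfl

theorem biconeOp_isBilimit {x y : C} {s : BinaryBicone x y} (hs : Nonempty s.IsBilimit) :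
    Nonempty (biconeOp s).IsBilimit :=
  ⟨isBinaryBilimitOfTotal _ (congrArg Quiver.Hom.op (binaryBicone_total hs))⟩

theorem addClosure_unop {P : ObjectProperty Cᵒᵖ} {x : Cᵒᵖ} (h : AddClosure P x) :
    AddClosure P.unop x.unop := by
  induction h with
  | of h => exact .of h
  | iso e _ ih => exact .iso e.unop.symm ih
  | zero h => exact .zero h.unop
  | sum s hs _ _ ih ih' => exact .sum (biconeUnop s) (biconeUnop_isBilimit ⟨hs⟩).some ih ih'
  | summand s hs _ ih => exact .summand (biconeUnop s) (biconeUnop_isBilimit ⟨hs⟩).some ih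

theorem addClosure_op {P : ObjectProperty C} {x : C} (h : AddClosure P x) :
    AddClosure P.op (op x) := by
  induction h with
  | of h => exact .of h
  | iso e _ ih => exact .iso e.symm.op ih
  | zero h => exact .zero h.op
  | sum s hs _ _ ih ih' => exact .sum (biconeOp s) (biconeOp_isBilimit ⟨hs⟩).some ih ih'
  | summand s hs _ ih => exact .summand (biconeOp s) (biconeOp_isBilimit ⟨hs⟩).some ih

theorem addClosure_op_iff {P : ObjectProperty C} {x : Cᵒᵖ} :
    AddClosure P.op x ↔ AddClosure P x.unop :=
  ⟨addClosure_unop, addClosure_op⟩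

omit [Preadditive C] in
theorem isRightApprox_op_iff {X : ObjectProperty C} {x y : Cᵒᵖ} {p : x ⟶ y} :
    IsRightApprox X.op p ↔ IsLeftApprox X p.unop := by
  refine and_congr Iff.rfl ⟨fun h x' hx' f => ?_, fun h x' hx' f => ?_⟩
  · obtain ⟨g, hg⟩ := h (op x') hx' f.op
    exact ⟨g.unop, congrArg Quiver.Hom.unop hg⟩
  · obtain ⟨g, hg⟩ := h x'.unop hx' f.unop
    exact ⟨g.op, Quiver.Hom.unop_inj hg⟩

omit [Preadditive C] in
theorem isLeftApprox_op_iff {X : ObjectProperty C} {x y : Cᵒᵖ} {p : x ⟶ y} :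
    IsLeftApprox X.op p ↔ IsRightApprox X p.unop := by
  refine and_congr Iff.rfl ⟨fun h x' hx' f => ?_, fun h x' hx' f => ?_⟩
  · obtain ⟨g, hg⟩ := h (op x') hx' f.op
    exact ⟨g.unop, congrArg Quiver.Hom.unop hg⟩
  · obtain ⟨g, hg⟩ := h x'.unop hx' f.unop
    exact ⟨g.op, Quiver.Hom.unop_inj hg⟩

namespace ExtData

variable (D : ExtData.{w} k C)

/-- The opposite extriangulation. -/
def op : ExtData.{w} k Cᵒᵖ where
  obj c a := D.obj a.unop c.unop
  addCommGroup c a := D.addCommGroup a.unop c.unop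
  module c a := D.module a.unop c.unop
  pull g a := D.push a.unop g.unop
  push c {_ _} f := D.pull f.unop c.unop
  pull_id c a := D.push_id a.unop c.unop
  pull_comp g h a := D.push_comp a.unop h.unop g.unop
  push_id c a := D.pull_id a.unop c.unop
  push_comp c {_ _ _} f h := D.pull_comp h.unop f.unop c.unop
  pull_push g f := (D.pull_push f.unop g.unop).symm
  pull_add g h a := D.push_add a.unop g.unop h.unop
  pull_smul t g a := D.push_smul a.unop t g.unop
  push_add c {_ _} f h := D.pull_add f.unop h.unop c.unop
  push_smul c {_ _} t f := D.pull_smul t f.unop c.unop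
  Realizes {a b c} δ f g := D.Realizes (a := c.unop) (b := b.unop) (c := a.unop) δ g.unop f.unop

variable {D}

theorem IsExtriangulated.op (hD : D.IsExtriangulated) : D.op.IsExtriangulated where
  hasFiniteBiproducts := by
    have := hD.hasFiniteBiproducts
    have : HasFiniteProducts Cᵒᵖ := inferInstance
    exact HasFiniteBiproducts.of_hasFiniteProducts
  exists_realizes {a c} δ := by
    obtain ⟨b, f, g, h⟩ := hD.exists_realizes (a := c.unop) (c := a.unop) δ
    exact ⟨Opposite.op b, g.op, f.op, h⟩
  realizes_iff {a b b' c δ f g} f' g' h := by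
    refine (hD.realizes_iff (b' := b'.unop) g'.unop f'.unop h).trans
      ⟨fun ⟨e, h₁, h₂⟩ => ⟨e.symm.op, ?_, ?_⟩, fun ⟨e, h₁, h₂⟩ => ⟨e.symm.unop, ?_, ?_⟩⟩
    · refine Quiver.Hom.unop_inj ?_
      simp [← h₂]
    · refine Quiver.Hom.unop_inj ?_
      simp [← h₁]
    · simp [← h₂]
    · simp [← h₁]
  lift {a b c a' b' c' δ δ' f g f' g'} α γ h h' e := by
    obtain ⟨β, h₁, h₂⟩ := hD.lift γ.unop α.unop h' h e.symm
    exact ⟨β.op, Quiver.Hom.unop_inj h₂.symm, Quiver.Hom.unop_inj h₁.symm⟩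
  zero {a c} s hs :=
    hD.zero (biconeSwap (biconeUnop s)) (biconeSwap_isBilimit (biconeUnop_isBilimit hs))
  add {a b c a' b' c' δ δ' f g f' g'} sa sb sc ha hb hc h h' := by
    have := hD.add (biconeUnop sc) (biconeUnop sb) (biconeUnop sa) (biconeUnop_isBilimit hc)
      (biconeUnop_isBilimit hb) (biconeUnop_isBilimit ha) h h'
    have e₀ : D.op.push sc.pt sa.inl (D.op.pull sc.fst a δ) +
        D.op.push sc.pt sa.inr (D.op.pull sc.snd a' δ') =
      D.push _ (biconeUnop sc).inl (D.pull (biconeUnop sa).fst c.unop δ) +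
        D.push _ (biconeUnop sc).inr (D.pull (biconeUnop sa).snd c'.unop δ') :=
      congrArg₂ (· + ·) (D.pull_push_apply (biconeUnop sa).fst (biconeUnop sc).inl δ)
        (D.pull_push_apply (biconeUnop sa).snd (biconeUnop sc).inr δ')
    have e₁ : (sa.fst ≫ f ≫ sb.inl + sa.snd ≫ f' ≫ sb.inr).unop =
      (biconeUnop sb).fst ≫ f.unop ≫ (biconeUnop sa).inl +
        (biconeUnop sb).snd ≫ f'.unop ≫ (biconeUnop sa).inr := by
      simp [biconeUnop]
      rfl
    have e₂ : (sb.fst ≫ g ≫ sc.inl + sb.snd ≫ g' ≫ sc.inr).unop =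
      (biconeUnop sc).fst ≫ g.unop ≫ (biconeUnop sb).inl +
        (biconeUnop sc).snd ≫ g'.unop ≫ (biconeUnop sb).inr := by
      simp [biconeUnop]
      rfl
    change D.Realizes (D.op.push sc.pt sa.inl (D.op.pull sc.fst a δ) +
        D.op.push sc.pt sa.inr (D.op.pull sc.snd a' δ')) (_ : _ ⟶ _).unop (_ : _ ⟶ _).unop
    rw [e₀, e₁, e₂]
    exact this
  et3 {a b c a' b' c' δ δ' f g f' g'} α β h h' e := by
    obtain ⟨γ, h₁, h₂⟩ := hD.et3op β.unop α.unop h' h (congrArg Quiver.Hom.unop e).symm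
    exact ⟨γ.op, Quiver.Hom.unop_inj h₁.symm, h₂.symm⟩
  et3op {a b c a' b' c' δ δ' f g f' g'} β γ h h' e := by
    obtain ⟨α, h₁, h₂⟩ := hD.et3 γ.unop β.unop h' h (congrArg Quiver.Hom.unop e).symm
    exact ⟨α.op, Quiver.Hom.unop_inj h₁.symm, h₂.symm⟩
  et4 {a b c d e δ δ' f f' g g'} h h' := by
    obtain ⟨x, h', i, p, δ'', h₁, h₂, h₃, h₄, h₅, h₆⟩ := hD.et4op h' h
    exact ⟨Opposite.op x, h'.op, p.op, i.op, δ'', h₁, Quiver.Hom.unop_inj h₂,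
      Quiver.Hom.unop_inj h₃, h₄, h₅, h₆.symm⟩
  et4op {a b c d e δ δ' f' f g' g} h h' := by
    obtain ⟨x, h', i, p, δ'', h₁, h₂, h₃, h₄, h₅, h₆⟩ := hD.et4 h' h
    exact ⟨Opposite.op x, h'.op, p.op, i.op, δ'', h₁, Quiver.Hom.unop_inj h₂,
      Quiver.Hom.unop_inj h₃, h₄, h₅, h₆.symm⟩

end ExtData

end Opposite

/-! ### Biproducts under additive functors and in full subcategories -/

section Bicones

theorem mapBinaryBicone_isBilimit {C : Type*} {C' : Type*} [Category* C] [Category* C']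
    [Preadditive C] [Preadditive C'] (F : C ⥤ C') [F.Additive] {x y : C} {s : BinaryBicone x y}
    (hs : Nonempty s.IsBilimit) : Nonempty (F.mapBinaryBicone s).IsBilimit :=
  ⟨isBinaryBilimitOfTotal _ (by
    have := congrArg F.map (binaryBicone_total hs)
    simp only [Functor.map_add, Functor.map_comp] at this
    exact this.trans (F.map_id _))⟩

/-- A bicone in a full subcategory. -/
def fullSubcategoryBicone {C : Type u} [Category.{v} C] [Preadditive C] {P : ObjectProperty C}
    {x y : C} (s : BinaryBicone x y) (hx : P x) (hy : P y) (hs : P s.pt) :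
    BinaryBicone (⟨x, hx⟩ : P.FullSubcategory) ⟨y, hy⟩ where
  pt := ⟨s.pt, hs⟩
  fst := ObjectProperty.homMk s.fst
  snd := ObjectProperty.homMk s.snd
  inl := ObjectProperty.homMk s.inl
  inr := ObjectProperty.homMk s.inr
  inl_fst := ObjectProperty.hom_ext _ s.inl_fst
  inl_snd := ObjectProperty.hom_ext _ s.inl_snd
  inr_fst := ObjectProperty.hom_ext _ s.inr_fst
  inr_snd := ObjectProperty.hom_ext _ s.inr_snd

theorem fullSubcategoryBicone_isBilimit {C : Type u} [Category.{v} C] [Preadditive C]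
    {P : ObjectProperty C} {x y : C} {s : BinaryBicone x y} (hx : P x) (hy : P y) (hs : P s.pt)
    (h : Nonempty s.IsBilimit) : Nonempty (fullSubcategoryBicone s hx hy hs).IsBilimit :=
  ⟨isBinaryBilimitOfTotal _ (ObjectProperty.hom_ext _ (binaryBicone_total h))⟩

theorem hasFiniteBiproducts_of_exists {C : Type*} [Category* C] [Preadditive C]
    (h₀ : ∃ o : C, IsZero o) (h : ∀ x y : C, ∃ s : BinaryBicone x y, Nonempty s.IsBilimit) :
    HasFiniteBiproducts C := by
  have : HasZeroObject C := ⟨h₀⟩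
  have : HasBinaryBiproducts C := ⟨fun x y => by
    obtain ⟨s, ⟨hs⟩⟩ := h x y
    exact HasBinaryBiproduct.mk ⟨s, hs⟩⟩
  have : HasFiniteProducts C := hasFiniteProducts_of_has_binary_and_terminal
  exact HasFiniteBiproducts.of_hasFiniteProducts

end Bicones

/-! ### Hereditary categories and the vanishing of higher extensions -/

theorem LinBifunctor.coend_mk_eq_zero {k : Type z} [Field k] {C : Type u} [Category.{v} C]
    [Preadditive C] [Linear k C] (F : LinBifunctor.{w₁} k C) (G : LinBifunctor.{w₂} k C)
    {a b c x : C} (g : b ⟶ x) (ξ : F.obj x a) (η : G.obj c b) (h : F.pull g a ξ = 0) :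
    (coendRel F G c a).mkQ (coendTmul F G x ξ (G.push c g η)) = 0 := by
  have hmem : coendTmul F G b (F.pull g a ξ) η - coendTmul F G x ξ (G.push c g η) ∈
      coendRel F G c a := Submodule.subset_span ⟨_, _, g, ξ, η, rfl⟩
  have h0 : coendTmul F G b (0 : F.obj b a) η = 0 := by simp [coendTmul]
  rw [h, h0, zero_sub, Submodule.neg_mem_iff] at hmem
  exact (Submodule.Quotient.mk_eq_zero _).2 hmem

namespace ExtData

variable {k : Type z} [Field k] {C : Type u} [Category.{v} C] [Preadditive C] [Linear k C]
  {D : ExtData.{w} k C}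

theorem eq_zero_of_addClosure_left {P : ObjectProperty C} {y : C}
    (h : ∀ x, P x → ∀ δ : D.obj x y, δ = 0) {x : C} (hx : AddClosure P x) (δ : D.obj x y) :
    δ = 0 := by
  induction hx with
  | of hx => exact h _ hx δ
  | iso e _ ih => exact D.eq_zero_of_pull_iso e _ (ih _)
  | zero hx => exact D.eq_zero_of_isZero_left hx δ
  | sum s hs _ _ ih ih' =>
    rw [← D.pull_id_apply δ, ← binaryBicone_total ⟨hs⟩, D.pull_add_apply, D.pull_comp_apply,
      D.pull_comp_apply, ih (D.pull s.inl y δ), ih' (D.pull s.inr y δ), map_zero, map_zero,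
      add_zero]
  | summand s hs _ ih =>
    rw [← D.pull_id_apply δ, ← s.inl_fst, D.pull_comp_apply, ih (D.pull s.fst y δ), map_zero]

theorem eq_zero_of_addClosure_right {P : ObjectProperty C} {x : C}
    (h : ∀ y, P y → ∀ δ : D.obj x y, δ = 0) {y : C} (hy : AddClosure P y) (δ : D.obj x y) :
    δ = 0 :=
  eq_zero_of_addClosure_left (D := D.op) (P := P.op) (y := Opposite.op x)
    (fun y hy δ => h y.unop hy δ) (addClosure_op hy) δ

section Hereditary

variable (hD : D.IsExtriangulated)
include hD

/-- Let `y ↣ e ↠ b` realize `η`. The kernel of `e ↠ b ↠ c` is an extension of `a` by `y` with class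
`f^* η = 0`, so it retracts onto `y`; pushing its class over `c` along the retraction gives the
preimage of `η`. -/
theorem IsExtriangulated.exists_pull_eq_of_pull_eq_zero {a b c : C} {δ : D.obj c a} {f : a ⟶ b}
    {g : b ⟶ c} (h : D.Realizes δ f g) {y : C} (η : D.obj b y) (hη : D.pull f y η = 0) :
    ∃ η' : D.obj c y, D.pull g y η' = η := by
  obtain ⟨e, j, p, h'⟩ := hD.exists_realizes η
  obtain ⟨x, h₁, i, t, δ'', -, -, -, h₂, -, h₃⟩ := hD.et4op h' h
  obtain ⟨ρ, hρ⟩ := hD.toPre.exists_desc h₂ (𝟙 y) (by rw [hη, map_zero])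
  refine ⟨D.push c ρ δ'', ?_⟩
  rw [D.pull_push_apply, ← h₃, ← D.push_comp_apply, hρ, D.push_id_apply]

/-- Let `x ↣ e ↠ a` realize `η`. Covariant right exactness lifts `δ` to an extension of `c` by `e`,
and (ET4) then yields a class over a realization of `δ`, hence over `b` up to isomorphism, that
restricts to `η`. -/
theorem IsHereditary.pull_surjective (hH : D.IsHereditary) {a b c : C} {f : a ⟶ b} {g : b ⟶ c}
    (h : D.IsConflation f g) (x : C) : Function.Surjective (D.pull f x) := by
  intro η
  obtain ⟨δ, h⟩ := h
  obtain ⟨e, j, p, h₁⟩ := hD.exists_realizes η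
  obtain ⟨δ', rfl⟩ := (hH c j p ⟨_, h₁⟩).2 δ
  obtain ⟨m, s, t, h₂⟩ := hD.exists_realizes δ'
  obtain ⟨X, _, i, q, δ'', -, -, -, h₃, h₄, -⟩ := hD.et4 h₁ h₂
  obtain ⟨ε, hε, -⟩ := (hD.realizes_iff _ _ h).1 h₃
  exact ⟨D.pull ε.hom x δ'', by rw [← D.pull_comp_apply, hε, h₄]⟩

theorem IsHereditary.op (hH : D.IsHereditary) : D.op.IsHereditary := by
  rintro x a b c f g ⟨δ, h⟩
  have h' : D.Realizes (a := c.unop) (b := b.unop) (c := a.unop) δ g.unop f.unop := h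
  refine ⟨fun η => ⟨fun hη => ?_, ?_⟩, hH.pull_surjective hD ⟨_, h'⟩ x.unop⟩
  · exact hD.exists_pull_eq_of_pull_eq_zero h' η hη
  · rintro ⟨η, rfl⟩
    refine (D.pull_comp_apply (a := x.unop) g.unop f.unop η).symm.trans ?_
    rw [hD.toPre.comp_eq_zero h']
    exact D.pull_zero _

/-- For a realization `a ↣ b ↠ x` of `ξ` with deflation `g`, heredity writes `η = g_* η'`; the coend
relation moves `g` across the tensor sign, and `g^* ξ = 0`. Higher degrees follow by induction,
their right tensor factor being already zero. -/
theorem IsHereditary.higher_succ_eq_zero (hH : D.IsHereditary) (n : ℕ) {c a : C}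
    (δ : (D.higher (n + 1)).obj c a) : δ = 0 := by
  suffices h : ∀ (x : C) (ξ : D.obj x a) (η : (D.higher n).obj c x),
      (LinBifunctor.coendRel D.toLinBifunctor (D.higher n) c a).mkQ
        (LinBifunctor.coendTmul D.toLinBifunctor (D.higher n) x ξ η) = 0 from
    LinearMap.congr_fun (LinBifunctor.coend_hom_ext (F := D.toLinBifunctor) (G := D.higher n)
      (φ := LinearMap.id) (ψ := 0) fun x ξ η => h x ξ η) δ
  intro x ξ η
  -- `higher 0` is `E` itself, so the base case here is the vanishing of `E^2`.
  cases n with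
  | zero =>
    obtain ⟨b, f, g, hξ⟩ := hD.exists_realizes ξ
    obtain ⟨η', hη'⟩ := (hH c f g ⟨_, hξ⟩).2 η.down
    have key : η = (D.higher 0).push c g (ULift.up η') := by
      apply ULift.down_injective
      exact hη'.symm
    rw [key]
    exact LinBifunctor.coend_mk_eq_zero _ _ g _ _ (hD.toPre.pull_self hξ)
  | succ n =>
    rw [IsHereditary.higher_succ_eq_zero hH n η]
    simp [LinBifunctor.coendTmul]

theorem IsHereditary.rightPerp_iff (hH : D.IsHereditary) {X : ObjectProperty C} {y : C} :
    D.rightPerp X y ↔ ∀ x, X x → ∀ δ : D.obj x y, δ = 0 := by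
  refine ⟨fun h x hx δ => congrArg ULift.down (h 0 x hx (ULift.up.{u} δ)), fun h n x hx δ => ?_⟩
  cases n with
  | zero => exact ULift.down_injective (h x hx δ.down)
  | succ n => exact hH.higher_succ_eq_zero hD n δ

theorem IsHereditary.leftPerp_iff (hH : D.IsHereditary) {X : ObjectProperty C} {y : C} :
    D.leftPerp X y ↔ ∀ x, X x → ∀ δ : D.obj y x, δ = 0 := by
  refine ⟨fun h x hx δ => congrArg ULift.down (h 0 x hx (ULift.up.{u} δ)), fun h n x hx δ => ?_⟩
  cases n with
  | zero => exact ULift.down_injective (h x hx δ.down)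
  | succ n => exact hH.higher_succ_eq_zero hD n δ

end Hereditary

theorem realizes_congr {a b c : C} {δ δ' : D.obj c a} {f f' : a ⟶ b} {g g' : b ⟶ c}
    (h : D.Realizes δ f g) (e : δ = δ') (e₁ : f = f') (e₂ : g = g') : D.Realizes δ' f' g' := by
  subst e e₁ e₂; exact h

/-! ### Extension-closed subcategories and `Z_R` -/

section Restrict

theorem IsExtriangulated.exists_bicone (hD : D.IsExtriangulated) (x y : C) :
    ∃ s : BinaryBicone x y, Nonempty s.IsBilimit := by
  have := hD.hasFiniteBiproducts
  have := hasBinaryBiproducts_of_finite_biproducts C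
  exact ⟨BinaryBiproduct.bicone x y, ⟨BinaryBiproduct.isBilimit x y⟩⟩

/-- The restriction of an extriangulation to an extension-closed subcategory. -/
theorem IsExtriangulated.restrict (hD : D.IsExtriangulated) {P : ObjectProperty C}
    (h₀ : ∀ o : C, IsZero o → P o)
    (hP : ∀ {a b c : C} (f : a ⟶ b) (g : b ⟶ c), D.IsConflation f g → P a → P c → P b) :
    (D.restrict P).IsExtriangulated where
  hasFiniteBiproducts := by
    refine hasFiniteBiproducts_of_exists ?_ fun x y => ?_
    · obtain ⟨o, ho⟩ := hD.toPre.exists_isZero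
      refine ⟨⟨o, h₀ o ho⟩, ?_⟩
      rw [IsZero.iff_id_eq_zero]
      exact ObjectProperty.hom_ext _ (ho.eq_of_src _ _)
    · obtain ⟨s, hs⟩ := hD.exists_bicone x.obj y.obj
      have hp : P s.pt := hP _ _ ⟨_, hD.zero s hs⟩ x.property y.property
      exact ⟨_, fullSubcategoryBicone_isBilimit x.property y.property hp hs⟩
  exists_realizes {a c} δ := by
    obtain ⟨b, f, g, h⟩ := hD.exists_realizes (a := a.obj) (c := c.obj) δ
    exact ⟨⟨b, hP f g ⟨_, h⟩ a.property c.property⟩, ObjectProperty.homMk f,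
      ObjectProperty.homMk g, h⟩
  realizes_iff {a b b' c δ f g} f' g' h := by
    refine (hD.realizes_iff f'.hom g'.hom h).trans
      ⟨fun ⟨e, h₁, h₂⟩ => ⟨P.isoMk e, ObjectProperty.hom_ext _ h₁, ObjectProperty.hom_ext _ h₂⟩,
        fun ⟨e, h₁, h₂⟩ => ⟨P.ι.mapIso e, congrArg (·.hom) h₁, congrArg (·.hom) h₂⟩⟩
  lift α γ h h' e := by
    obtain ⟨β, h₁, h₂⟩ := hD.lift α.hom γ.hom h h' e
    exact ⟨ObjectProperty.homMk β, ObjectProperty.hom_ext _ h₁, ObjectProperty.hom_ext _ h₂⟩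
  zero s hs := hD.zero (P.ι.mapBinaryBicone s) (mapBinaryBicone_isBilimit P.ι hs)
  add sa sb sc ha hb hc h h' :=
    hD.add (P.ι.mapBinaryBicone sa) (P.ι.mapBinaryBicone sb) (P.ι.mapBinaryBicone sc)
      (mapBinaryBicone_isBilimit P.ι ha) (mapBinaryBicone_isBilimit P.ι hb)
      (mapBinaryBicone_isBilimit P.ι hc) h h'
  et3 α β h h' e := by
    obtain ⟨γ, h₁, h₂⟩ := hD.et3 α.hom β.hom h h' (congrArg (·.hom) e)
    exact ⟨ObjectProperty.homMk γ, ObjectProperty.hom_ext _ h₁, h₂⟩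
  et3op β γ h h' e := by
    obtain ⟨α, h₁, h₂⟩ := hD.et3op β.hom γ.hom h h' (congrArg (·.hom) e)
    exact ⟨ObjectProperty.homMk α, ObjectProperty.hom_ext _ h₁, h₂⟩
  et4 {a b c d e δ δ' f f' g g'} h h' := by
    obtain ⟨x, h', i, p, δ'', h₁, h₂, h₃, h₄, h₅, h₆⟩ := hD.et4 h h'
    exact ⟨⟨x, hP i p ⟨_, h₄⟩ d.property e.property⟩, ObjectProperty.homMk h',
      ObjectProperty.homMk i, ObjectProperty.homMk p, δ'', h₁, ObjectProperty.hom_ext _ h₂,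
      ObjectProperty.hom_ext _ h₃, h₄, h₅, h₆⟩
  et4op {a b c d e δ δ' f' f g' g} h h' := by
    obtain ⟨x, h', i, p, δ'', h₁, h₂, h₃, h₄, h₅, h₆⟩ := hD.et4op h h'
    exact ⟨⟨x, hP i p ⟨_, h₄⟩ d.property e.property⟩, ObjectProperty.homMk h',
      ObjectProperty.homMk i, ObjectProperty.homMk p, δ'', h₁, ObjectProperty.hom_ext _ h₂,
      ObjectProperty.hom_ext _ h₃, h₄, h₅, h₆⟩

theorem IsHereditary.restrict (hH : D.IsHereditary) (P : ObjectProperty C) :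
    (D.restrict P).IsHereditary :=
  fun x _ _ _ f g ⟨δ, h⟩ => hH x.obj f.hom g.hom ⟨δ, h⟩

theorem IsHereditary.zProp_iff (hH : D.IsHereditary) (hD : D.IsExtriangulated)
    {R : ObjectProperty C} {y : C} : D.zProp R y ↔
      (∀ r, R r → ∀ δ : D.obj r y, δ = 0) ∧ ∀ r, R r → ∀ δ : D.obj y r, δ = 0 :=
  and_congr (hH.rightPerp_iff hD) (hH.leftPerp_iff hD)

theorem IsHereditary.zProp_of_conflation (hH : D.IsHereditary) (hD : D.IsExtriangulated)
    {R : ObjectProperty C} {a b c : C} {f : a ⟶ b} {g : b ⟶ c} (h : D.IsConflation f g)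
    (ha : D.zProp R a) (hc : D.zProp R c) : D.zProp R b := by
  rw [hH.zProp_iff hD] at *
  refine ⟨fun r hr δ => ?_, fun r hr δ => ?_⟩
  · obtain ⟨δ', rfl⟩ := ((hH r f g h).1 δ).1 (hc.1 r hr _)
    rw [ha.1 r hr δ', map_zero]
  · obtain ⟨_, h⟩ := h
    obtain ⟨δ', rfl⟩ := hD.exists_pull_eq_of_pull_eq_zero h δ (ha.2 r hr _)
    rw [hc.2 r hr δ', map_zero]

theorem IsHereditary.onZ_isExtriangulated (hH : D.IsHereditary) (hD : D.IsExtriangulated)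
    (R : ObjectProperty C) : (D.onZ R).IsExtriangulated :=
  hD.restrict (fun _ ho => (hH.zProp_iff hD).2
    ⟨fun _ _ _ => D.eq_zero_of_isZero_right ho _, fun _ _ _ => D.eq_zero_of_isZero_left ho _⟩)
    fun _ _ h => hH.zProp_of_conflation hD h

end Restrict

end ExtData

/-! ### The ideal quotient by projective-injective objects -/

section

variable (k : Type z) [Field k] {C : Type u} [Category.{v} C] [Preadditive C] [Linear k C]
  (R : ObjectProperty C)

/-- The projection to the ideal quotient. -/
abbrev toIdealQuotient : C ⥤ IdealQuotient k R := CategoryTheory.Quotient.functor (idealRel k R)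

variable {k R}

theorem exists_eq_toIdealQuotient_obj (x : IdealQuotient k R) :
    ∃ x₀ : C, x = (toIdealQuotient k R).obj x₀ := ⟨x.as, rfl⟩

theorem toIdealQuotient_map_eq_iff {x y : C} (f g : x ⟶ y) :
    (toIdealQuotient k R).map f = (toIdealQuotient k R).map g ↔ f - g ∈ factorIdeal k R x y :=
  CategoryTheory.Quotient.functor_map_eq_iff _ _ _

end

namespace ExtData

variable {k : Type z} [Field k] {C : Type u} [Category.{v} C] [Preadditive C] [Linear k C]
  {D : ExtData.{w} k C} {R : ObjectProperty C}

/-- Objects of `R` are injective, so the first factor of a map through `R` extends along the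
inflation. Keeping the extension inside the ideal is what lets squares that commute only modulo
`[R]` be corrected to commuting ones. -/
theorem IsPreExtriangulated.exists_desc_mem (hD : D.IsPreExtriangulated) (hR : R ≤ D.projInj)
    {a b c : C} {δ : D.obj c a} {f : a ⟶ b} {g : b ⟶ c} (h : D.Realizes δ f g) {y : C}
    {t : a ⟶ y} (ht : t ∈ factorIdeal k R a y) : ∃ t' ∈ factorIdeal k R b y, f ≫ t' = t := by
  induction ht using Submodule.span_induction with
  | mem t ht =>
    obtain ⟨r, p, q, hr, rfl⟩ := ht
    obtain ⟨p', hp⟩ := hD.exists_desc h p ((hR r hr).2 _ _)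
    exact ⟨p' ≫ q, Submodule.subset_span ⟨r, p', q, hr, rfl⟩, by rw [reassoc_of% hp]⟩
  | zero => exact ⟨0, Submodule.zero_mem _, comp_zero⟩
  | add t s _ _ ht hs =>
    obtain ⟨t', ht', rfl⟩ := ht
    obtain ⟨s', hs', rfl⟩ := hs
    exact ⟨t' + s', Submodule.add_mem _ ht' hs', Preadditive.comp_add _ _ _ _ _ _⟩
  | smul r t _ ht =>
    obtain ⟨t', ht', rfl⟩ := ht
    exact ⟨r • t', Submodule.smul_mem _ _ ht', Linear.comp_smul _ _ _ _ _ _⟩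

theorem IsPreExtriangulated.exists_lift_mem (hD : D.IsPreExtriangulated) (hR : R ≤ D.projInj)
    {a b c : C} {δ : D.obj c a} {f : a ⟶ b} {g : b ⟶ c} (h : D.Realizes δ f g) {x : C}
    {t : x ⟶ c} (ht : t ∈ factorIdeal k R x c) : ∃ t' ∈ factorIdeal k R x b, t' ≫ g = t := by
  induction ht using Submodule.span_induction with
  | mem t ht =>
    obtain ⟨r, p, q, hr, rfl⟩ := ht
    obtain ⟨q', hq⟩ := hD.exists_lift h q ((hR r hr).1 _ _)
    exact ⟨p ≫ q', Submodule.subset_span ⟨r, p, q', hr, rfl⟩, by rw [Category.assoc, hq]⟩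
  | zero => exact ⟨0, Submodule.zero_mem _, zero_comp⟩
  | add t s _ _ ht hs =>
    obtain ⟨t', ht', rfl⟩ := ht
    obtain ⟨s', hs', rfl⟩ := hs
    exact ⟨t' + s', Submodule.add_mem _ ht' hs', Preadditive.add_comp _ _ _ _ _ _⟩
  | smul r t _ ht =>
    obtain ⟨t', ht', rfl⟩ := ht
    exact ⟨r • t', Submodule.smul_mem _ _ ht', Linear.smul_comp _ _ _ _ _ _⟩

theorem quotient_realizes_map (hR : R ≤ D.projInj) {a b c : C} {δ : D.obj c a} {f : a ⟶ b}
    {g : b ⟶ c} (h : D.Realizes δ f g) :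
    (D.quotient R hR).Realizes (a := (toIdealQuotient k R).obj a) (c := (toIdealQuotient k R).obj c)
      δ ((toIdealQuotient k R).map f) ((toIdealQuotient k R).map g) :=
  ⟨b, f, g, Iso.refl _, h, Category.comp_id _, Category.id_comp _⟩

theorem exists_of_quotient_realizes (hR : R ≤ D.projInj) {a c : C} {b : IdealQuotient k R}
    {δ : (D.quotient R hR).obj ((toIdealQuotient k R).obj c) ((toIdealQuotient k R).obj a)}
    {f : (toIdealQuotient k R).obj a ⟶ b} {g : b ⟶ (toIdealQuotient k R).obj c}
    (h : (D.quotient R hR).Realizes δ f g) :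
    ∃ (b₀ : C) (f₀ : a ⟶ b₀) (g₀ : b₀ ⟶ c) (e : (toIdealQuotient k R).obj b₀ ≅ b),
      D.Realizes (δ : D.obj c a) f₀ g₀ ∧ (toIdealQuotient k R).map f₀ ≫ e.hom = f ∧
        e.hom ≫ g = (toIdealQuotient k R).map g₀ := h

/-- These axioms come first because additivity and (ET4) require moving realizations along
isomorphisms of the quotient, which `isIso_of_ends` and `realizes_of_isos` derive from them. -/
theorem quotient_isPreExtriangulated (hD : D.IsExtriangulated) (hR : R ≤ D.projInj) :
    (D.quotient R hR).IsPreExtriangulated where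
  exists_isZero := by
    obtain ⟨o, ho⟩ := hD.toPre.exists_isZero
    exact ⟨_, (toIdealQuotient k R).map_isZero ho⟩
  exists_realizes {a c} δ := by
    obtain ⟨b, f, g, h⟩ := hD.exists_realizes (a := a.as) (c := c.as) δ
    exact ⟨_, _, _, quotient_realizes_map hR h⟩
  realizes_iff {a b b' c δ f g} f' g' h := by
    obtain ⟨a, rfl⟩ := exists_eq_toIdealQuotient_obj a
    obtain ⟨c, rfl⟩ := exists_eq_toIdealQuotient_obj c
    obtain ⟨b₀, f₀, g₀, e, h₀, h₁, h₂⟩ := exists_of_quotient_realizes hR h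
    constructor
    · rintro ⟨b₁, f₁, g₁, e', h', h₁', h₂'⟩
      change (toIdealQuotient k R).map f₁ ≫ e'.hom = f' at h₁'
      change e'.hom ≫ g' = (toIdealQuotient k R).map g₁ at h₂'
      obtain ⟨ε, rfl, rfl⟩ := (hD.realizes_iff _ _ h₀).1 h'
      refine ⟨e.symm ≪≫ (toIdealQuotient k R).mapIso ε ≪≫ e', ?_, ?_⟩
      · simp [← h₁, ← h₁']
      · simp [h₂', ← Functor.map_comp, ← h₂]
    · rintro ⟨ε, rfl, rfl⟩
      refine ⟨b₀, f₀, g₀, e ≪≫ ε, h₀, ?_, ?_⟩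
      · simp [← h₁]
      · simpa using h₂
  lift {a b c a' b' c' δ δ' f g f' g'} α γ h h' hδ := by
    obtain ⟨a, rfl⟩ := exists_eq_toIdealQuotient_obj a
    obtain ⟨c, rfl⟩ := exists_eq_toIdealQuotient_obj c
    obtain ⟨a', rfl⟩ := exists_eq_toIdealQuotient_obj a'
    obtain ⟨c', rfl⟩ := exists_eq_toIdealQuotient_obj c'
    obtain ⟨b₀, f₀, g₀, e, h, h₁, h₂⟩ := exists_of_quotient_realizes hR h
    obtain ⟨b₁, f₁, g₁, e', h', h₁', h₂'⟩ := exists_of_quotient_realizes hR h'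
    obtain ⟨α, rfl⟩ := (toIdealQuotient k R).map_surjective α
    obtain ⟨γ, rfl⟩ := (toIdealQuotient k R).map_surjective γ
    obtain ⟨β, h₃, h₄⟩ := hD.lift α γ h h' hδ
    refine ⟨e.inv ≫ (toIdealQuotient k R).map β ≫ e'.hom, ?_, ?_⟩
    · rw [← h₁, ← h₁', Category.assoc, Iso.hom_inv_id_assoc, ← Functor.map_comp_assoc, h₃,
        Functor.map_comp_assoc]
    · rw [Category.assoc, Category.assoc, h₂', ← Functor.map_comp, ← h₄, Functor.map_comp, ← h₂]
      simp
  zero {a c} s hs := by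
    obtain ⟨a, rfl⟩ := exists_eq_toIdealQuotient_obj a
    obtain ⟨c, rfl⟩ := exists_eq_toIdealQuotient_obj c
    obtain ⟨t, ht⟩ := hD.exists_bicone a c
    refine ⟨t.pt, t.inl, t.snd, biconeIso (Iso.refl _) (Iso.refl _)
      (mapBinaryBicone_isBilimit (toIdealQuotient k R) ht) hs, hD.zero t ht, ?_, ?_⟩
    · exact (inl_biconeIso_hom (Iso.refl _) (Iso.refl _) (mapBinaryBicone_isBilimit _ ht)
        hs).trans (Category.id_comp _)
    · exact (biconeIso_hom_snd (Iso.refl _) (Iso.refl _) (mapBinaryBicone_isBilimit _ ht)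
        hs).trans (Category.comp_id _)
  et3 {a b c a' b' c' δ δ' f g f' g'} α β h h' hc := by
    obtain ⟨a, rfl⟩ := exists_eq_toIdealQuotient_obj a
    obtain ⟨c, rfl⟩ := exists_eq_toIdealQuotient_obj c
    obtain ⟨a', rfl⟩ := exists_eq_toIdealQuotient_obj a'
    obtain ⟨c', rfl⟩ := exists_eq_toIdealQuotient_obj c'
    obtain ⟨b₀, f₀, g₀, e, h, h₁, h₂⟩ := exists_of_quotient_realizes hR h
    obtain ⟨b₁, f₁, g₁, e', h', h₁', h₂'⟩ := exists_of_quotient_realizes hR h'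
    obtain ⟨α, rfl⟩ := (toIdealQuotient k R).map_surjective α
    obtain ⟨β₀, hβ⟩ := (toIdealQuotient k R).map_surjective (e.hom ≫ β ≫ e'.inv)
    -- The lifted square commutes only up to the ideal. The defect extends along `f₀` to some `t` in
    -- the ideal, so `β₀ - t` represents the same morphism and makes the square commute in `C`.
    have hm : f₀ ≫ β₀ - α ≫ f₁ ∈ factorIdeal k R a b₁ := by
      rw [← toIdealQuotient_map_eq_iff, Functor.map_comp, Functor.map_comp, hβ, reassoc_of% h₁,
        reassoc_of% hc, ← h₁']
      simp
    obtain ⟨t, ht, hft⟩ := hD.toPre.exists_desc_mem hR h hm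
    obtain ⟨γ, h₃, h₄⟩ := hD.et3 α (β₀ - t) h h' (by rw [Preadditive.comp_sub, hft]; abel)
    refine ⟨(toIdealQuotient k R).map γ, ?_, h₄⟩
    have hβt : (toIdealQuotient k R).map (β₀ - t) = (toIdealQuotient k R).map β₀ := by
      rw [toIdealQuotient_map_eq_iff]
      simpa using ht
    rw [← cancel_epi e.hom, reassoc_of% h₂, ← Functor.map_comp, h₃, Functor.map_comp, hβt, hβ,
      ← h₂']
    simp
  et3op {a b c a' b' c' δ δ' f g f' g'} β γ h h' hc := by
    obtain ⟨a, rfl⟩ := exists_eq_toIdealQuotient_obj a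
    obtain ⟨c, rfl⟩ := exists_eq_toIdealQuotient_obj c
    obtain ⟨a', rfl⟩ := exists_eq_toIdealQuotient_obj a'
    obtain ⟨c', rfl⟩ := exists_eq_toIdealQuotient_obj c'
    obtain ⟨b₀, f₀, g₀, e, h, h₁, h₂⟩ := exists_of_quotient_realizes hR h
    obtain ⟨b₁, f₁, g₁, e', h', h₁', h₂'⟩ := exists_of_quotient_realizes hR h'
    obtain ⟨γ, rfl⟩ := (toIdealQuotient k R).map_surjective γ
    obtain ⟨β₀, hβ⟩ := (toIdealQuotient k R).map_surjective (e.hom ≫ β ≫ e'.inv)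
    have hm : β₀ ≫ g₁ - g₀ ≫ γ ∈ factorIdeal k R b₀ c' := by
      rw [← toIdealQuotient_map_eq_iff, Functor.map_comp, Functor.map_comp, hβ, ← h₂, ← h₂']
      simp [hc]
    obtain ⟨t, ht, hft⟩ := hD.toPre.exists_lift_mem hR h' hm
    obtain ⟨α, h₃, h₄⟩ := hD.et3op (β₀ - t) γ h h' (by rw [Preadditive.sub_comp, hft]; abel)
    refine ⟨(toIdealQuotient k R).map α, ?_, h₄⟩
    have hβt : (toIdealQuotient k R).map (β₀ - t) = (toIdealQuotient k R).map β₀ := by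
      rw [toIdealQuotient_map_eq_iff]
      simpa using ht
    rw [← h₁, ← h₁', ← Functor.map_comp_assoc, ← h₃, Functor.map_comp_assoc, hβt, hβ]
    simp

/-- The extension modules of the quotient are those of `C` by definition, so the axiom in `C` can be
read there directly. The same holds for the two versions of (ET4) below. -/
theorem quotient_add_map (hD : D.IsExtriangulated) (hR : R ≤ D.projInj) {a b c a' b' c' : C}
    {δ : (D.quotient R hR).obj ((toIdealQuotient k R).obj c) ((toIdealQuotient k R).obj a)}
    {δ' : (D.quotient R hR).obj ((toIdealQuotient k R).obj c') ((toIdealQuotient k R).obj a')}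
    {f : a ⟶ b} {g : b ⟶ c} {f' : a' ⟶ b'} {g' : b' ⟶ c'} (sa : BinaryBicone a a')
    (sb : BinaryBicone b b') (sc : BinaryBicone c c') (ha : Nonempty sa.IsBilimit)
    (hb : Nonempty sb.IsBilimit) (hc : Nonempty sc.IsBilimit)
    (h : D.Realizes (δ : D.obj c a) f g) (h' : D.Realizes (δ' : D.obj c' a') f' g') :
    (D.quotient R hR).Realizes
      ((D.quotient R hR).push _ ((toIdealQuotient k R).mapBinaryBicone sa).inl
          ((D.quotient R hR).pull ((toIdealQuotient k R).mapBinaryBicone sc).fst _ δ) +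
        (D.quotient R hR).push _ ((toIdealQuotient k R).mapBinaryBicone sa).inr
          ((D.quotient R hR).pull ((toIdealQuotient k R).mapBinaryBicone sc).snd _ δ'))
      ((toIdealQuotient k R).map (sa.fst ≫ f ≫ sb.inl + sa.snd ≫ f' ≫ sb.inr))
      ((toIdealQuotient k R).map (sb.fst ≫ g ≫ sc.inl + sb.snd ≫ g' ≫ sc.inr)) :=
  quotient_realizes_map hR (hD.add sa sb sc ha hb hc h h')

theorem quotient_et4_map (hD : D.IsExtriangulated) (hR : R ≤ D.projInj) {a b c d e : C}
    {δ : (D.quotient R hR).obj ((toIdealQuotient k R).obj d) ((toIdealQuotient k R).obj a)}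
    {δ' : (D.quotient R hR).obj ((toIdealQuotient k R).obj e) ((toIdealQuotient k R).obj b)}
    {f : a ⟶ b} {f' : b ⟶ d} {g : b ⟶ c} {g' : c ⟶ e}
    (h : D.Realizes (δ : D.obj d a) f f') (h' : D.Realizes (δ' : D.obj e b) g g') :
    ∃ (x : C) (h' : c ⟶ x) (i : d ⟶ x) (p : x ⟶ e)
      (δ'' : (D.quotient R hR).obj ((toIdealQuotient k R).obj x) ((toIdealQuotient k R).obj a)),
      (D.quotient R hR).Realizes δ'' ((toIdealQuotient k R).map (f ≫ g))
        ((toIdealQuotient k R).map h') ∧ g ≫ h' = f' ≫ i ∧ h' ≫ p = g' ∧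
      (D.quotient R hR).Realizes ((D.quotient R hR).push _ ((toIdealQuotient k R).map f') δ')
        ((toIdealQuotient k R).map i) ((toIdealQuotient k R).map p) ∧
      (D.quotient R hR).pull ((toIdealQuotient k R).map i) _ δ'' = δ ∧
      (D.quotient R hR).push _ ((toIdealQuotient k R).map f) δ'' =
        (D.quotient R hR).pull ((toIdealQuotient k R).map p) _ δ' := by
  obtain ⟨x, j, i, p, δ'', k₁, k₂, k₃, k₄, k₅, k₆⟩ := hD.et4 h h'
  exact ⟨x, j, i, p, δ'', quotient_realizes_map hR k₁, k₂, k₃, quotient_realizes_map hR k₄, k₅, k₆⟩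

theorem quotient_et4op_map (hD : D.IsExtriangulated) (hR : R ≤ D.projInj) {a b c d e : C}
    {δ : (D.quotient R hR).obj ((toIdealQuotient k R).obj b) ((toIdealQuotient k R).obj d)}
    {δ' : (D.quotient R hR).obj ((toIdealQuotient k R).obj c) ((toIdealQuotient k R).obj e)}
    {f' : d ⟶ a} {f : a ⟶ b} {g' : e ⟶ b} {g : b ⟶ c}
    (h : D.Realizes (δ : D.obj b d) f' f) (h' : D.Realizes (δ' : D.obj c e) g' g) :
    ∃ (x : C) (h' : x ⟶ a) (i : d ⟶ x) (p : x ⟶ e)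
      (δ'' : (D.quotient R hR).obj ((toIdealQuotient k R).obj c) ((toIdealQuotient k R).obj x)),
      (D.quotient R hR).Realizes δ'' ((toIdealQuotient k R).map h')
        ((toIdealQuotient k R).map (f ≫ g)) ∧ h' ≫ f = p ≫ g' ∧ i ≫ h' = f' ∧
      (D.quotient R hR).Realizes ((D.quotient R hR).pull ((toIdealQuotient k R).map g') _ δ)
        ((toIdealQuotient k R).map i) ((toIdealQuotient k R).map p) ∧
      (D.quotient R hR).push _ ((toIdealQuotient k R).map p) δ'' = δ' ∧
      (D.quotient R hR).push _ ((toIdealQuotient k R).map i) δ =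
        (D.quotient R hR).pull ((toIdealQuotient k R).map g) _ δ'' := by
  obtain ⟨x, j, i, p, δ'', k₁, k₂, k₃, k₄, k₅, k₆⟩ := hD.et4op h h'
  exact ⟨x, j, i, p, δ'', quotient_realizes_map hR k₁, k₂, k₃, quotient_realizes_map hR k₄, k₅, k₆⟩

/-- The ideal quotient of an extriangulated category by projective-injective objects. -/
theorem quotient_isExtriangulated (hD : D.IsExtriangulated) (hR : R ≤ D.projInj) :
    (D.quotient R hR).IsExtriangulated where
  hasFiniteBiproducts := by
    refine hasFiniteBiproducts_of_exists (quotient_isPreExtriangulated hD hR).exists_isZero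
      fun x y => ?_
    obtain ⟨s, hs⟩ := hD.exists_bicone x.as y.as
    exact ⟨(toIdealQuotient k R).mapBinaryBicone s, mapBinaryBicone_isBilimit _ hs⟩
  exists_realizes := (quotient_isPreExtriangulated hD hR).exists_realizes
  realizes_iff := (quotient_isPreExtriangulated hD hR).realizes_iff
  lift := (quotient_isPreExtriangulated hD hR).lift
  zero := (quotient_isPreExtriangulated hD hR).zero
  et3 := (quotient_isPreExtriangulated hD hR).et3
  et3op := (quotient_isPreExtriangulated hD hR).et3op
  add {a b c a' b' c' δ δ' f g f' g'} sa sb sc ha hb hc h h' := by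
    obtain ⟨a, rfl⟩ := exists_eq_toIdealQuotient_obj a
    obtain ⟨c, rfl⟩ := exists_eq_toIdealQuotient_obj c
    obtain ⟨a', rfl⟩ := exists_eq_toIdealQuotient_obj a'
    obtain ⟨c', rfl⟩ := exists_eq_toIdealQuotient_obj c'
    obtain ⟨b₀, f₀, g₀, e, h, h₁, h₂⟩ := exists_of_quotient_realizes hR h
    obtain ⟨b₁, f₁, g₁, e', h', h₁', h₂'⟩ := exists_of_quotient_realizes hR h'
    obtain ⟨ta, hta⟩ := hD.exists_bicone a a'
    obtain ⟨tb, htb⟩ := hD.exists_bicone b₀ b₁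
    obtain ⟨tc, htc⟩ := hD.exists_bicone c c'
    have hta' := mapBinaryBicone_isBilimit (toIdealQuotient k R) hta
    have htb' := mapBinaryBicone_isBilimit (toIdealQuotient k R) htb
    have htc' := mapBinaryBicone_isBilimit (toIdealQuotient k R) htc
    -- The given biproducts need not come from `C`; the sum is formed on biproducts chosen in `C`
    -- and then transported.
    refine (quotient_isPreExtriangulated hD hR).realizes_of_isos
      (quotient_add_map hD hR ta tb tc hta htb htc h h')
      (biconeIso (Iso.refl _) (Iso.refl _) hta' ha) (biconeIso e e' htb' hb)
      (biconeIso (Iso.refl _) (Iso.refl _) htc' hc) ?_ ?_ ?_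
    · rw [map_add, map_add, ← LinBifunctor.push_comp_apply, ← LinBifunctor.push_comp_apply,
        inl_biconeIso_hom, inr_biconeIso_hom, LinBifunctor.pull_push_apply,
        LinBifunctor.pull_push_apply, ← LinBifunctor.pull_comp_apply,
        ← LinBifunctor.pull_comp_apply, biconeIso_hom_fst, biconeIso_hom_snd]
      simp only [Iso.refl_hom, Category.id_comp, Category.comp_id]
    · rw [Functor.map_add, Functor.map_comp, Functor.map_comp, Functor.map_comp, Functor.map_comp]
      exact biconeMap_comp_biconeIso (s := (toIdealQuotient k R).mapBinaryBicone ta)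
        (t := (toIdealQuotient k R).mapBinaryBicone tb) (Iso.refl _) (Iso.refl _) hta' ha e e'
        htb' hb (by simp [h₁]) (by simp [h₁'])
    · rw [Functor.map_add, Functor.map_comp, Functor.map_comp, Functor.map_comp, Functor.map_comp]
      exact biconeMap_comp_biconeIso (s := (toIdealQuotient k R).mapBinaryBicone tb)
        (t := (toIdealQuotient k R).mapBinaryBicone tc) e e' htb' hb (Iso.refl _) (Iso.refl _)
        htc' hc (by simp [h₂]) (by simp [h₂'])
  et4 {a b c d x δ δ' f f' g g'} h hg := by
    have hQ := quotient_isPreExtriangulated hD hR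
    obtain ⟨a, rfl⟩ := exists_eq_toIdealQuotient_obj a
    obtain ⟨b, rfl⟩ := exists_eq_toIdealQuotient_obj b
    obtain ⟨d, rfl⟩ := exists_eq_toIdealQuotient_obj d
    obtain ⟨x, rfl⟩ := exists_eq_toIdealQuotient_obj x
    obtain ⟨b₀, f₀, f₁, e, h, h₁, h₂⟩ := exists_of_quotient_realizes hR h
    -- The second conflation starts at an object that is only isomorphic to the image of `b₀`.
    -- Transporting its class to `b₀` makes the two conflations composable in `C`, and `β`
    -- identifies the middle terms.
    obtain ⟨c₁, p, q, h'⟩ := hD.exists_realizes (a := b₀) (c := x)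
      ((D.quotient R hR).push ((toIdealQuotient k R).obj x) e.inv δ')
    obtain ⟨β, h₃, h₄⟩ := hQ.lift e.inv (𝟙 _) hg (quotient_realizes_map hR h')
      ((D.quotient R hR).pull_id_apply _).symm
    have := hQ.isIso_of_ends hg (quotient_realizes_map hR h') e.symm (Iso.refl _) β
      ((D.quotient R hR).pull_id_apply _).symm h₃ h₄
    obtain ⟨X, j, i, r, δ'', k₁, k₂, k₃, k₄, k₅, k₆⟩ := quotient_et4_map hD hR h h'
    refine ⟨(toIdealQuotient k R).obj X, β ≫ (toIdealQuotient k R).map j,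
      (toIdealQuotient k R).map i, (toIdealQuotient k R).map r, δ'',
      realizes_congr (hQ.realizes_of_iso k₁ (asIso β).symm) rfl ?_ rfl, ?_, ?_,
      realizes_congr k₄ ?_ rfl rfl, k₅, ?_⟩
    · change (toIdealQuotient k R).map (f₀ ≫ p) ≫ inv β = _
      rw [IsIso.comp_inv_eq, Category.assoc, h₃, ← h₁]
      simp
    · rw [reassoc_of% h₃, ← Functor.map_comp, k₂, Functor.map_comp, ← h₂]
      simp
    · rw [Category.assoc, ← Functor.map_comp, k₃, ← h₄, Category.comp_id]
    · rw [← LinBifunctor.push_comp_apply, ← h₂, Iso.inv_hom_id_assoc]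
    · rw [← h₁, LinBifunctor.push_comp_apply, k₆, ← LinBifunctor.pull_push_apply,
        ← LinBifunctor.push_comp_apply, Iso.inv_hom_id, LinBifunctor.push_id_apply]
  et4op {a b c d x δ δ' f' f g' g} h h' := by
    have hQ := quotient_isPreExtriangulated hD hR
    obtain ⟨b, rfl⟩ := exists_eq_toIdealQuotient_obj b
    obtain ⟨c, rfl⟩ := exists_eq_toIdealQuotient_obj c
    obtain ⟨d, rfl⟩ := exists_eq_toIdealQuotient_obj d
    obtain ⟨x, rfl⟩ := exists_eq_toIdealQuotient_obj x
    obtain ⟨b₀, f₀, f₁, e, hg, h₁, h₂⟩ := exists_of_quotient_realizes hR h'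
    -- Dually, the conflation ending at the shared object is moved so that it ends at `b₀`.
    obtain ⟨a₁, p, q, hp⟩ := hD.exists_realizes (a := d) (c := b₀)
      ((D.quotient R hR).pull e.hom ((toIdealQuotient k R).obj d) δ)
    obtain ⟨β, h₃, h₄⟩ := hQ.lift (𝟙 _) e.hom (quotient_realizes_map hR hp) h
      ((D.quotient R hR).push_id_apply _)
    have := hQ.isIso_of_ends (quotient_realizes_map hR hp) h (Iso.refl _) e β
      ((D.quotient R hR).push_id_apply _) h₃ h₄
    obtain ⟨X, j, i, r, δ'', k₁, k₂, k₃, k₄, k₅, k₆⟩ := quotient_et4op_map hD hR hp hg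
    refine ⟨(toIdealQuotient k R).obj X, (toIdealQuotient k R).map j ≫ β,
      (toIdealQuotient k R).map i, (toIdealQuotient k R).map r, δ'',
      realizes_congr (hQ.realizes_of_iso k₁ (asIso β)) rfl rfl ?_, ?_, ?_,
      realizes_congr k₄ ?_ rfl rfl, k₅, ?_⟩
    · change inv β ≫ _ = _
      rw [IsIso.inv_comp_eq, ← reassoc_of% h₄, h₂, Functor.map_comp]
    · rw [Category.assoc, ← h₄, ← Functor.map_comp_assoc, k₂, ← h₁, Functor.map_comp_assoc]
    · rw [← Functor.map_comp_assoc, k₃, h₃, Category.id_comp]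
    · rw [← LinBifunctor.pull_comp_apply, h₁]
    · rw [show g = e.inv ≫ (toIdealQuotient k R).map f₁ by rw [← h₂, Iso.inv_hom_id_assoc],
        LinBifunctor.pull_comp_apply, ← k₆, LinBifunctor.pull_push_apply,
        ← LinBifunctor.pull_comp_apply, Iso.inv_hom_id, LinBifunctor.pull_id_apply]

end ExtData

/-- The bicone attached to a split sequence. -/
def biconeOfSplit {C : Type u} [Category.{v} C] [Preadditive C] {a b c : C} {f : a ⟶ b} {g : b ⟶ c}
    {r : b ⟶ a} {s : c ⟶ b} (h₁ : f ≫ r = 𝟙 a) (h₂ : s ≫ g = 𝟙 c) (h₃ : f ≫ g = 0)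
    (h₄ : s ≫ r = 0) : BinaryBicone a c where
  pt := b
  fst := r
  snd := g
  inl := f
  inr := s

namespace ExtData

open Opposite

variable {k : Type z} [Field k] {C : Type u} [Category.{v} C] [Preadditive C] [Linear k C]
  {D : ExtData.{w} k C}

/-! ### Split conflations, pullbacks and pushouts -/

section Split

variable (hD : D.IsExtriangulated)
include hD

theorem IsExtriangulated.exists_split {a b c : C} {f : a ⟶ b} {g : b ⟶ c}
    (h : D.Realizes 0 f g) : ∃ (r : b ⟶ a) (s : c ⟶ b), f ≫ r = 𝟙 a ∧ s ≫ g = 𝟙 c ∧ f ≫ g = 0 ∧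
      s ≫ r = 0 ∧ r ≫ f + g ≫ s = 𝟙 b := by
  obtain ⟨t, ht⟩ := hD.exists_bicone a c
  obtain ⟨e, rfl, h₂⟩ := (hD.realizes_iff _ _ (hD.zero t ht)).1 h
  have hg : g = e.inv ≫ t.snd := by simp [← h₂]
  subst hg
  refine ⟨e.inv ≫ t.fst, t.inr ≫ e.hom, by simp, by simp, by simp, by simp, ?_⟩
  have := congrArg (fun f => e.inv ≫ f ≫ e.hom) (binaryBicone_total ht)
  simpa using this

/-- In a split conflation the retraction is a deflation. -/
theorem IsExtriangulated.exists_retraction {a b c : C} {f : a ⟶ b} {g : b ⟶ c}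
    (h : D.Realizes 0 f g) : ∃ (r : b ⟶ a) (s : c ⟶ b), f ≫ r = 𝟙 a ∧ s ≫ g = 𝟙 c ∧
      D.Realizes 0 s r := by
  obtain ⟨r, s, h₁, h₂, h₃, h₄, h₅⟩ := hD.exists_split h
  exact ⟨r, s, h₁, h₂, hD.zero (biconeSwap (biconeOfSplit h₁ h₂ h₃ h₄))
    (biconeSwap_isBilimit ⟨isBinaryBilimitOfTotal _ h₅⟩)⟩

theorem IsExtriangulated.addClosure_left_of_split {P : ObjectProperty C} {a b c : C} {f : a ⟶ b}
    {g : b ⟶ c} (h : D.Realizes 0 f g) (hb : AddClosure P b) : AddClosure P a := by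
  obtain ⟨r, s, h₁, h₂, h₃, h₄, h₅⟩ := hD.exists_split h
  exact .summand (biconeOfSplit h₁ h₂ h₃ h₄) (isBinaryBilimitOfTotal _ h₅) hb

theorem IsExtriangulated.addClosure_right_of_split {P : ObjectProperty C} {a b c : C} {f : a ⟶ b}
    {g : b ⟶ c} (h : D.Realizes 0 f g) (hb : AddClosure P b) : AddClosure P c := by
  obtain ⟨r, s, -, -, h'⟩ := hD.exists_retraction h
  exact hD.addClosure_left_of_split h' hb

theorem IsExtriangulated.addClosure_middle_of_split {P : ObjectProperty C} {a b c : C} {f : a ⟶ b}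
    {g : b ⟶ c} (h : D.Realizes 0 f g) (ha : AddClosure P a) (hc : AddClosure P c) :
    AddClosure P b := by
  obtain ⟨r, s, h₁, h₂, h₃, h₄, h₅⟩ := hD.exists_split h
  exact .sum (biconeOfSplit h₁ h₂ h₃ h₄) (isBinaryBilimitOfTotal _ h₅) ha hc

/-- The pullback of two deflations. -/
theorem IsExtriangulated.exists_pullback {a b a' b' c : C} {f : a ⟶ b} {g : b ⟶ c} {f' : a' ⟶ b'}
    {g' : b' ⟶ c} (h : D.IsConflation f g) (h' : D.IsConflation f' g') :
    ∃ (x : C) (i : a' ⟶ x) (p : x ⟶ b) (i' : a ⟶ x) (p' : x ⟶ b'),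
      D.IsConflation i p ∧ D.IsConflation i' p' := by
  obtain ⟨δ, h⟩ := h
  obtain ⟨δ', h'⟩ := h'
  obtain ⟨x, i, p, hx⟩ := hD.exists_realizes (D.pull g a' δ')
  -- `n` is the kernel of `x ↠ b ↠ c`. It is an extension of `a` by `a'` with class `f^* g^* δ' =
  -- 0`, hence a biproduct of the two.
  obtain ⟨n, j, s, t, δ'', k₁, -, -, k₂, k₃, k₄⟩ := hD.et4op hx h
  rw [← D.pull_comp_apply, hD.toPre.comp_eq_zero h, D.pull_zero] at k₂
  obtain ⟨r, σ, h₁, h₂, h₃, h₄, h₅⟩ := hD.exists_split k₂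
  -- The retraction `r` need not carry `δ''` to `δ'`, but both classes agree after pulling back
  -- along `g`, so they differ by some `m_* δ`. Changing `r` to `r - t ≫ m` removes the difference.
  obtain ⟨m, hm⟩ := hD.toPre.exists_push_eq h (D.push c r δ'' - δ') (by
    rw [map_sub, D.pull_push_apply, ← k₄, ← D.push_comp_apply, h₁, D.push_id_apply, sub_self])
  have hr : D.push c (r - t ≫ m) δ'' = δ' := by
    have := D.push_add_apply (c := c) (r - t ≫ m) (t ≫ m) δ''
    rw [sub_add_cancel, D.push_comp_apply, k₃, ← hm] at this
    rw [← sub_eq_iff_eq_add, sub_sub_cancel] at this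
    exact this.symm
  have hs : D.Realizes (0 : D.obj a' a) (σ + m ≫ s) (r - t ≫ m) := by
    refine hD.zero (biconeSwap (biconeOfSplit (f := s) (g := t) (r := r - t ≫ m) (s := σ + m ≫ s)
      ?_ ?_ h₃ ?_)) (biconeSwap_isBilimit ⟨isBinaryBilimitOfTotal _ ?_⟩)
    · simp [h₁, reassoc_of% h₃]
    · simp [h₂, h₃]
    · simp [h₄, h₁, reassoc_of% h₂, reassoc_of% h₃]
    · change (r - t ≫ m) ≫ s + t ≫ (σ + m ≫ s) = 𝟙 n
      rw [← h₅]
      simp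
  -- The cokernel of `a ↣ n ↣ x` realizes `(r - t ≫ m)_* δ'' = δ'`, so it is `b'` up to isomorphism.
  obtain ⟨b₁, u, i₁, q, θ, l₁, -, -, l₂, -, -⟩ := hD.et4 hs k₁
  rw [hr] at l₂
  obtain ⟨e, -, -⟩ := (hD.realizes_iff _ _ l₂).1 h'
  exact ⟨x, i, p, _, _, ⟨_, hx⟩, ⟨_, hD.toPre.realizes_of_isos l₁ (Iso.refl _) (Iso.refl _) e
    (δ' := D.pull e.inv a θ) (by
      rw [← D.pull_comp_apply, e.hom_inv_id, D.pull_id_apply]; exact D.push_id_apply _)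
    (f' := (σ + m ≫ s) ≫ j) (g' := u ≫ e.hom) (by simp) (by simp)⟩⟩

end Split

/-- The pushout of two inflations. -/
theorem IsExtriangulated.exists_pushout (hD : D.IsExtriangulated) {a b c b' c' : C} {f : a ⟶ b}
    {g : b ⟶ c} {f' : a ⟶ b'} {g' : b' ⟶ c'} (h : D.IsConflation f g) (h' : D.IsConflation f' g') :
    ∃ (x : C) (i : b ⟶ x) (p : x ⟶ c') (i' : b' ⟶ x) (p' : x ⟶ c),
      D.IsConflation i p ∧ D.IsConflation i' p' := by
  obtain ⟨δ, h⟩ := h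
  obtain ⟨δ', h'⟩ := h'
  obtain ⟨x, i, p, i', p', ⟨θ, k₁⟩, ⟨θ', k₂⟩⟩ := hD.op.exists_pullback (f := g.op) (g := f.op)
    (f' := g'.op) (g' := f'.op) ⟨δ, h⟩ ⟨δ', h'⟩
  exact ⟨x.unop, p.unop, i.unop, p'.unop, i'.unop, ⟨θ, k₁⟩, ⟨θ', k₂⟩⟩

/-! ### Self-duality of the 0-Auslander condition -/

section ZeroAuslander

theorem op_proj : D.op.proj = D.inj.op :=
  funext fun _ => propext ⟨fun h y => h (Opposite.op y), fun h y => h y.unop⟩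

theorem op_inj : D.op.inj = D.proj.op :=
  funext fun _ => propext ⟨fun h y => h (Opposite.op y), fun h y => h y.unop⟩

theorem op_projInj : D.op.projInj = D.projInj.op := by
  rw [projInj, projInj, op_proj, op_inj, inf_comm]
  rfl

theorem IsHereditary.inj_of_conflation (hH : D.IsHereditary) {a b c : C} {f : a ⟶ b} {g : b ⟶ c}
    (h : D.IsConflation f g) (hb : D.inj b) : D.inj c := by
  intro y δ
  obtain ⟨δ, rfl⟩ := (hH y f g h).2 δ
  rw [hb y δ, map_zero]

/-- Take a projective cover-type deflation `q ↠ x` and an inflation of `q` into a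
projective-injective `i`. By (ET4) the cokernel of `ker ↣ q ↣ i` is an extension of `i/q` by `x`;
both cokernels are injective since heredity passes injectivity from `i` to them. -/
theorem IsZeroAuslander.exists_inj_coresolution (h : D.IsZeroAuslander) (x : C) :
    ∃ (y y' : C) (f : x ⟶ y) (g : y ⟶ y'), D.inj y ∧ D.inj y' ∧ D.IsConflation f g := by
  obtain ⟨q, p, hq, l, m, δ, hp⟩ := h.enoughProjectives x
  obtain ⟨i, s, hi, y', t, δ', hs⟩ := h.exists_inflation q hq
  obtain ⟨y, _, f, g, _, k₁, -, -, k₂, -, -⟩ := h.isExtriangulated.et4 hp hs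
  exact ⟨y, y', f, g, h.hereditary.inj_of_conflation ⟨_, k₁⟩ hi.2,
    h.hereditary.inj_of_conflation ⟨_, hs⟩ hi.2, ⟨_, k₂⟩⟩

theorem IsZeroAuslander.exists_deflation (h : D.IsZeroAuslander) {y : C} (hy : D.inj y) :
    ∃ (q : C) (p : q ⟶ y), D.projInj q ∧ D.IsDeflation p := by
  have hD := h.isExtriangulated
  obtain ⟨q, p, hq, l, m, δ, hp⟩ := h.enoughProjectives y
  obtain ⟨i, s, hi, c, t, δ', hs⟩ := h.exists_inflation q hq
  obtain ⟨x, r, f, g, _, k₁, -, -, k₂, -, -⟩ := hD.et4 hp hs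
  -- As `y` is injective, its inflation into the quotient `x` of the projective-injective object
  -- splits, so that object maps onto `x` and then onto `y` by deflations.
  rw [hy _ (D.push c p δ')] at k₂
  obtain ⟨ρ, σ, -, -, k₃⟩ := hD.exists_retraction k₂
  obtain ⟨n, j, -, -, δ'', k₄, -⟩ := hD.et4op k₁ k₃
  exact ⟨i, r ≫ ρ, hi, n, j, δ'', k₄⟩

theorem IsZeroAuslander.op (h : D.IsZeroAuslander) : D.op.IsZeroAuslander where
  isExtriangulated := h.isExtriangulated.op
  hereditary := h.hereditary.op h.isExtriangulated
  enoughProjectives x := by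
    obtain ⟨y, y', f, g, hy, -, δ, hc⟩ := h.exists_inj_coresolution x.unop
    exact ⟨Opposite.op y, f.op, by rw [op_proj]; exact hy, Opposite.op y', g.op, δ, hc⟩
  exists_inflation y hy := by
    rw [op_proj] at hy
    obtain ⟨q, p, hq, l, m, δ, hp⟩ := h.exists_deflation hy
    exact ⟨Opposite.op q, p.op, by rw [op_projInj]; exact hq, Opposite.op l, m.op, δ, hp⟩

end ZeroAuslander

end ExtData

/-! ### Orthogonality, approximations and their behaviour under duality -/

namespace ExtData

open Opposite

variable {k : Type z} [Field k] {C : Type u} [Category.{v} C] [Preadditive C] [Linear k C]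

section

variable (D : ExtData.{w} k C) (R : ObjectProperty C)

/-- The objects `y` with `E(r, y) = 0` for all `r` in `R`. -/
def rightOrth : ObjectProperty C := fun y => ∀ r, R r → ∀ δ : D.obj r y, δ = 0

/-- The objects `y` with `E(y, r) = 0` for all `r` in `R`. -/
def leftOrth : ObjectProperty C := fun y => ∀ r, R r → ∀ δ : D.obj y r, δ = 0

/-- The kernels of right `add(R, proj ∩ inj)`-approximations of injective objects. -/
def approxKernel : ObjectProperty C := fun u => ∃ (r' y : C) (i : u ⟶ r') (p : r' ⟶ y),
  D.inj y ∧ D.IsConflation i p ∧ IsRightApprox (D.addProjInj R) p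

/-- The cokernels of left `add(R, proj ∩ inj)`-approximations of projective objects. -/
def approxCokernel : ObjectProperty C := fun v => ∃ (r' x : C) (i : x ⟶ r') (p : r' ⟶ v),
  D.proj x ∧ D.IsConflation i p ∧ IsLeftApprox (D.addProjInj R) i

theorem op_leftOrth : D.op.leftOrth R.op = (D.rightOrth R).op :=
  funext fun _ => propext ⟨fun h y => h (Opposite.op y), fun h y => h y.unop⟩

theorem op_rightOrth : D.op.rightOrth R.op = (D.leftOrth R).op :=
  funext fun _ => propext ⟨fun h y => h (Opposite.op y), fun h y => h y.unop⟩

theorem op_addProjInj : D.op.addProjInj R.op = (D.addProjInj R).op := by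
  unfold addProjInj
  rw [op_projInj, ← ObjectProperty.op_sup]
  exact funext fun _ => propext addClosure_op_iff

theorem op_approxKernel : D.op.approxKernel R.op = (D.approxCokernel R).op := by
  refine funext fun u => propext ⟨?_, ?_⟩
  · rintro ⟨r, y, i, p, hy, ⟨δ, h⟩, hp⟩
    rw [op_inj] at hy
    rw [op_addProjInj, isRightApprox_op_iff] at hp
    exact ⟨r.unop, y.unop, p.unop, i.unop, hy, ⟨δ, h⟩, hp⟩
  · rintro ⟨r, y, i, p, hy, ⟨δ, h⟩, hp⟩
    refine ⟨Opposite.op r, Opposite.op y, p.op, i.op, ?_, ⟨δ, h⟩, ?_⟩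
    · rw [op_inj]; exact hy
    · rw [op_addProjInj, isRightApprox_op_iff]; exact hp

theorem op_bongartzMax : D.op.bongartzMax R.op = (D.bongartzMin R).op := by
  change AddClosure (R.op ⊔ D.op.projInj ⊔ D.op.approxKernel R.op) = _
  rw [op_projInj, op_approxKernel, ← ObjectProperty.op_sup, ← ObjectProperty.op_sup]
  exact funext fun _ => propext addClosure_op_iff

theorem AdmitsBongartz.op {D : ExtData.{w} k C} {R : ObjectProperty C} (h : D.AdmitsBongartz R) :
    D.op.AdmitsBongartz R.op := by
  refine ⟨fun y hy => ?_, fun x hx => ?_⟩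
  · rw [op_inj] at hy
    obtain ⟨r, i, ⟨v, p, δ, hi⟩, ha⟩ := h.2 y.unop hy
    refine ⟨Opposite.op r, i.op, ⟨Opposite.op v, p.op, δ, hi⟩, ?_⟩
    rw [op_addProjInj, isRightApprox_op_iff]
    exact ha
  · rw [op_proj] at hx
    obtain ⟨r, i, ⟨v, p, δ, hi⟩, ha⟩ := h.1 x.unop hx
    refine ⟨Opposite.op r, i.op, ⟨Opposite.op v, p.op, δ, hi⟩, ?_⟩
    rw [op_addProjInj, isLeftApprox_op_iff]
    exact ha

end

variable {D : ExtData.{w} k C} {R : ObjectProperty C}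

section

theorem rightOrth_addProjInj {y : C} (h : D.rightOrth R y) : D.rightOrth (D.addProjInj R) y :=
  fun _ ha δ => eq_zero_of_addClosure_left
    (fun x hx δ => hx.elim (fun hx => h x hx δ) (fun hx => hx.1 y δ)) ha δ

theorem leftOrth_addProjInj {y : C} (h : D.leftOrth R y) : D.leftOrth (D.addProjInj R) y :=
  fun _ ha δ => eq_zero_of_addClosure_right
    (fun x hx δ => hx.elim (fun hx => h x hx δ) (fun hx => hx.2 y δ)) ha δ

theorem addProjInj_le_rightOrth (hR : R ≤ D.rightOrth R) : D.addProjInj R ≤ D.rightOrth R :=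
  fun _ ha r hr δ => leftOrth_addProjInj (y := r) (fun r' hr' => hR r' hr' r hr) _ ha δ

theorem addProjInj_le_leftOrth (hR : R ≤ D.rightOrth R) : D.addProjInj R ≤ D.leftOrth R :=
  fun _ ha r hr δ => rightOrth_addProjInj (hR r hr) _ ha δ

theorem addProjInj_mono {Q : ObjectProperty C} (h : R ≤ Q) : D.addProjInj R ≤ D.addProjInj Q := by
  intro x hx
  induction hx with
  | of hx => exact .of (hx.imp (h _) id)
  | iso e _ ih => exact .iso e ih
  | zero h => exact .zero h
  | sum s hs _ _ ih ih' => exact .sum s hs ih ih'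
  | summand s hs _ ih => exact .summand s hs ih

end

section

variable (hD : D.IsExtriangulated) (hR : R ≤ D.rightOrth R)
include hD hR

/-- A Wakamatsu-type argument: an extension of `r` by `u` dies in `r'`, so it is pulled back from a
map `r ⟶ y`. That map factors through the approximation, along which the class vanishes. -/
theorem approxKernel_le_rightOrth : D.approxKernel R ≤ D.rightOrth R := by
  rintro u ⟨r', y, i, p, -, ⟨ε, h⟩, hr', hp⟩ r hr δ
  obtain ⟨t, rfl⟩ := hD.toPre.exists_pull_eq h δ (addProjInj_le_rightOrth hR _ hr' r hr _)
  obtain ⟨g, rfl⟩ := hp r (.of (Or.inl hr)) t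
  rw [D.pull_comp_apply, hD.toPre.pull_self h, map_zero]

variable (hH : D.IsHereditary)
include hH

omit hR in
-- By heredity every extension of `u` by `x` is restricted from `r'`, which lies in `add(R, proj ∩
-- inj)` and so has no extensions by `x`.
theorem approxKernel_le_leftOrth_rightOrth :
    D.approxKernel R ≤ D.leftOrth (D.rightOrth R) := by
  rintro u ⟨r', y, i, p, -, h, hr', -⟩ x hx δ
  obtain ⟨δ, rfl⟩ := hH.pull_surjective hD h x δ
  rw [rightOrth_addProjInj hx _ hr' δ, map_zero]

omit hR in
theorem bongartzMax_le_leftOrth_rightOrth : D.bongartzMax R ≤ D.leftOrth (D.rightOrth R) := by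
  intro x hx y hy δ
  refine eq_zero_of_addClosure_left (fun x hx δ => ?_) hx δ
  obtain (hx | hx) | hx := hx
  · exact hy x hx δ
  · exact hx.1 y δ
  · exact approxKernel_le_leftOrth_rightOrth hD hH x hx y hy δ

theorem bongartzMax_le_leftOrth : D.bongartzMax R ≤ D.leftOrth R :=
  fun x hx r hr => bongartzMax_le_leftOrth_rightOrth hD hH x hx r (hR r hr)

omit hH in
theorem bongartzMax_le_rightOrth : D.bongartzMax R ≤ D.rightOrth R := by
  intro x hx r hr δ
  refine eq_zero_of_addClosure_right (fun x hx δ => ?_) hx δ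
  obtain (hx | hx) | hx := hx
  · exact hR x hx r hr δ
  · exact hx.2 r δ
  · exact approxKernel_le_rightOrth hD hR x hx r hr δ

end

theorem op_le_rightOrth (hR : R ≤ D.rightOrth R) : R.op ≤ D.op.rightOrth R.op :=
  fun x hx r hr δ => hR r.unop hr x.unop hx δ

theorem rightOrth_of_conflation (hH : D.IsHereditary) {a b c : C} {f : a ⟶ b} {g : b ⟶ c}
    (h : D.IsConflation f g) (ha : D.rightOrth R a) (hc : D.rightOrth R c) : D.rightOrth R b := by
  intro r hr δ
  obtain ⟨δ', rfl⟩ := ((hH r f g h).1 δ).1 (hc r hr _)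
  rw [ha r hr δ', map_zero]

theorem leftOrth_of_conflation (hD : D.IsExtriangulated) {a b c : C} {f : a ⟶ b} {g : b ⟶ c}
    (h : D.IsConflation f g) (ha : D.leftOrth R a) (hc : D.leftOrth R c) : D.leftOrth R b := by
  intro r hr δ
  obtain ⟨_, h⟩ := h
  obtain ⟨δ', rfl⟩ := hD.exists_pull_eq_of_pull_eq_zero h δ (ha r hr _)
  rw [hc r hr δ', map_zero]

/-! ### Resolutions and approximations in 0-Auslander categories -/

section

variable (h : D.IsZeroAuslander) (hR : R ≤ D.rightOrth R) (hB : D.AdmitsBongartz R)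
include h hR

omit hR in
include hB in
/-- Objects of `R^⊥` are resolved by kernels of approximations of injective objects. -/
theorem IsZeroAuslander.exists_approxKernel_resolution {x : C} (hx : D.rightOrth R x) :
    ∃ (u w : C) (f : u ⟶ w) (g : w ⟶ x), D.approxKernel R u ∧ D.approxKernel R w ∧
      D.IsConflation f g := by
  have hD := h.isExtriangulated
  obtain ⟨y, y', i, q, hy, hy', δ', hi⟩ := h.exists_inj_coresolution x
  obtain ⟨r, p, ⟨u, j, δ, hp⟩, hr, hap⟩ := hB.1 y hy
  -- `w` is the kernel of `r ↠ y ↠ y'`. This composite is again an approximation: maps into `y'`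
  -- lift to `y` because `E(a, x) = 0` for `a` in `add(R, proj ∩ inj)`, and then to `r`.
  obtain ⟨w, s, f, g, δ'', k₁, -, -, k₂, -, -⟩ := hD.et4op hp hi
  refine ⟨u, w, f, g, ⟨r, y, j, p, hy, ⟨_, hp⟩, hr, hap⟩,
    ⟨r, y', s, p ≫ q, hy', ⟨_, k₁⟩, hr, fun a ha t => ?_⟩, ⟨_, k₂⟩⟩
  obtain ⟨t', rfl⟩ := hD.toPre.exists_lift hi t (rightOrth_addProjInj hx a ha _)
  obtain ⟨t'', rfl⟩ := hap a ha t'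
  exact ⟨t'', (Category.assoc _ _ _).symm⟩

include hB in
/-- Kernels of approximations of injective objects admit inflations into `add(R, proj ∩ inj)`. -/
theorem IsZeroAuslander.exists_inflation_of_approxKernel {u : C} (hu : D.approxKernel R u) :
    ∃ (s v : C) (f : u ⟶ s) (g : s ⟶ v), D.addProjInj R s ∧ D.rightOrth R v ∧
      D.leftOrth R v ∧ D.IsConflation f g := by
  have hD := h.isExtriangulated
  have hH := h.hereditary
  obtain ⟨r', y, i, p, hy, hc, hr', -⟩ := hu
  obtain ⟨q, p', hq, l, i', hc'⟩ := h.exists_deflation hy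
  -- The kernel `l` of `q ↠ y` is projective, so it has a left approximation `l ↣ r`, with cokernel
  -- `v`. The pullback `x` of `r'` and `q` over `y` lies in `l ↣ x ↠ r'` and `u ↣ x ↠ q`.
  have hl : D.proj l := by
    intro x δ
    obtain ⟨δ', rfl⟩ := hH.pull_surjective hD hc' x δ
    rw [hq.1 x δ', map_zero]
  obtain ⟨x, _, _, _, _, hx, hx'⟩ := hD.exists_pullback hc hc'
  obtain ⟨r, j, ⟨v, t, hj⟩, hap⟩ := hB.2 l hl
  have hv : D.approxCokernel R v := ⟨r, l, j, t, hl, hj, hap⟩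
  have hv' : D.op.approxKernel R.op (Opposite.op v) := by rw [op_approxKernel]; exact hv
  have hvl : D.leftOrth R v := by
    have := approxKernel_le_rightOrth hD.op (op_le_rightOrth hR) _ hv'
    rwa [op_rightOrth] at this
  have hvr : D.rightOrth R v := by
    have := approxKernel_le_leftOrth_rightOrth hD.op (hH.op hD) _ hv'
    exact fun r hr => this (Opposite.op r) (op_le_rightOrth hR _ hr)
  -- The pushout `s` is an extension of `r'` by `r`, split by rigidity, so it lies in `add(R, proj ∩
  -- inj)`; it also fits into `x ↣ s ↠ v`.
  obtain ⟨s, _, _, _, _, ⟨θ, k₁⟩, ⟨_, k₂⟩⟩ := hD.exists_pushout hj hx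
  have hs : D.addProjInj R s := by
    have h₀ : θ = 0 := rightOrth_addProjInj (addProjInj_le_rightOrth hR _ hap.1) _ hr' θ
    subst h₀
    exact hD.addClosure_middle_of_split k₁ hap.1 hr'
  obtain ⟨_, hx'⟩ := hx'
  -- The cokernel `X` of `u ↣ x ↣ s` is an extension of `v` by the projective-injective `q`, so it
  -- has the orthogonality of `v`.
  obtain ⟨X, _, _, _, _, l₁, -, -, l₂, -, -⟩ := hD.et4 hx' k₂
  exact ⟨s, X, _, _, hs, rightOrth_of_conflation hH ⟨_, l₂⟩ (fun r _ => hq.2 r) hvr,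
    leftOrth_of_conflation hD ⟨_, l₂⟩ (fun r _ => hq.1 r) hvl, ⟨_, l₁⟩⟩

include hB in
/-- An object of `R^⊥` on which `E(-, R^⊥ ∩ ^⊥R)` vanishes is a direct summand of the kernel of an
approximation, with complement in `R^⊥ ∩ ^⊥R`. -/
theorem IsZeroAuslander.exists_split_approxKernel {x : C} (hx : D.rightOrth R x)
    (hx' : ∀ y, D.rightOrth R y → D.leftOrth R y → ∀ δ : D.obj x y, δ = 0) :
    ∃ (u w : C) (f : u ⟶ w) (g : w ⟶ x), D.approxKernel R u ∧ D.approxKernel R w ∧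
      D.Realizes 0 f g := by
  have hD := h.isExtriangulated
  obtain ⟨u, w, f, g, hu, hw, δ, hfg⟩ := h.exists_approxKernel_resolution hB hx
  have h₀ : δ = 0 := hx' u (approxKernel_le_rightOrth hD hR u hu) (fun r hr =>
    approxKernel_le_leftOrth_rightOrth hD h.hereditary u hu r (hR r hr)) δ
  subst h₀
  exact ⟨u, w, f, g, hu, hw, hfg⟩

include hB in
theorem IsZeroAuslander.bongartzMax_of_proj {x : C} (hx : D.rightOrth R x)
    (hx' : ∀ y, D.rightOrth R y → D.leftOrth R y → ∀ δ : D.obj x y, δ = 0) :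
    D.bongartzMax R x := by
  obtain ⟨u, w, f, g, hu, hw, hfg⟩ := h.exists_split_approxKernel hR hB hx hx'
  exact h.isExtriangulated.addClosure_right_of_split hfg (.of (Or.inr hw))

include hB in
-- Since `x` is a summand of a kernel `w` with complement `u`, the inflation of `w` restricts to
-- `x`. The new cokernel is an extension of the old one by `u`, hence still orthogonal to `R` on
-- both sides.
theorem IsZeroAuslander.exists_inflation_of_proj {x : C} (hx : D.rightOrth R x)
    (hx' : ∀ y, D.rightOrth R y → D.leftOrth R y → ∀ δ : D.obj x y, δ = 0) :
    ∃ (s v : C) (f : x ⟶ s) (g : s ⟶ v), D.addProjInj R s ∧ D.rightOrth R v ∧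
      D.leftOrth R v ∧ D.IsConflation f g := by
  have hD := h.isExtriangulated
  have hH := h.hereditary
  obtain ⟨u, w, f, g, hu, hw, hfg⟩ := h.exists_split_approxKernel hR hB hx hx'
  obtain ⟨_, _, -, -, k⟩ := hD.exists_retraction hfg
  obtain ⟨s, v, _, _, hs, hvr, hvl, _, k'⟩ := h.exists_inflation_of_approxKernel hR hB hw
  obtain ⟨X, _, _, _, _, l₁, -, -, l₂, -, -⟩ := hD.et4 k k'
  exact ⟨s, X, _, _, hs,
    rightOrth_of_conflation hH ⟨_, l₂⟩ (approxKernel_le_rightOrth hD hR u hu) hvr,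
    leftOrth_of_conflation hD ⟨_, l₂⟩ (fun r hr =>
      approxKernel_le_leftOrth_rightOrth hD hH u hu r (hR r hr)) hvl, ⟨_, l₁⟩⟩

omit hR in
/-- Objects `y` with `E(^⊥R, y) = 0` admit right approximations by larger rigid subcategories whose
kernels lie in `R^⊥ ∩ ^⊥R`. -/
theorem IsZeroAuslander.exists_rightApprox {Q : ObjectProperty C} (hQ : Q ≤ D.rightOrth Q)
    (hRQ : R ≤ Q) (hB : D.AdmitsBongartz Q) {y : C}
    (hy : ∀ x, D.leftOrth R x → ∀ δ : D.obj x y, δ = 0) :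
    ∃ (s m : C) (f : m ⟶ s) (g : s ⟶ y), IsRightApprox (D.addProjInj Q) g ∧ D.rightOrth R m ∧
      D.leftOrth R m ∧ D.IsConflation f g := by
  have hD := h.isExtriangulated
  have hH := h.hereditary
  have hyQ : D.rightOrth Q y := fun q hq => hy q fun r hr => hQ r (hRQ r hr) q hq
  obtain ⟨u, w, f, g, hu, hw, _, k⟩ := h.exists_approxKernel_resolution hB hyQ
  obtain ⟨s, v, j, t, hs, -, hvl, _, k'⟩ := h.exists_inflation_of_approxKernel hQ hB hw
  obtain ⟨X, p, i, _, _, l₁, l₂, -, l₃, -, -⟩ := hD.et4 k k'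
  -- The quotient `X` of `s` by `u` is an extension of `v` by `y`. It splits because `v` lies in
  -- `^⊥R`, so `s ↠ X ↠ y` is a deflation.
  rw [hy v (fun r hr => hvl r (hRQ r hr)) (D.push v g _)] at l₃
  obtain ⟨ρ, σ, hρ, -, l₄⟩ := hD.exists_retraction l₃
  obtain ⟨m, a, _, _, _, n₁, -⟩ := hD.et4op l₁ l₄
  have hap : IsRightApprox (D.addProjInj Q) (p ≫ ρ) := by
    refine ⟨hs, fun x hx e => ?_⟩
    -- A map to `y` lifts to `w` because the kernel `u` is right orthogonal to `add(Q, proj ∩ inj)`;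
    -- composing with `w ↣ s` factors it through the new deflation.
    obtain ⟨e', rfl⟩ := hD.toPre.exists_lift k e
      (rightOrth_addProjInj (approxKernel_le_rightOrth hD hQ u hu) x hx _)
    refine ⟨e' ≫ j, ?_⟩
    rw [Category.assoc, reassoc_of% l₂, hρ, Category.comp_id]
  refine ⟨s, m, a, p ≫ ρ, hap, fun r hr δ => ?_, fun r hr δ => ?_, ⟨_, n₁⟩⟩
  · obtain ⟨e, rfl⟩ := hD.toPre.exists_pull_eq n₁ δ
      (addProjInj_le_rightOrth hQ s hs r (hRQ r hr) _)
    obtain ⟨e', rfl⟩ := hap.2 r (.of (Or.inl (hRQ r hr))) e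
    rw [D.pull_comp_apply, hD.toPre.pull_self n₁, map_zero]
  · obtain ⟨δ', rfl⟩ := hH.pull_surjective hD ⟨_, n₁⟩ r δ
    rw [addProjInj_le_leftOrth hQ s hs r (hRQ r hr) δ', map_zero]

end

end ExtData

theorem exists_factor_of_addClosure {C : Type u} [Category.{v} C] [Preadditive C]
    {P : ObjectProperty C} {s y : C} {p : s ⟶ y}
    (h : ∀ x, P x → ∀ f : x ⟶ y, ∃ g : x ⟶ s, g ≫ p = f) {x : C} (hx : AddClosure P x)
    (f : x ⟶ y) : ∃ g : x ⟶ s, g ≫ p = f := by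
  induction hx with
  | of hx => exact h _ hx f
  | iso e _ ih =>
    obtain ⟨g, hg⟩ := ih (e.hom ≫ f)
    exact ⟨e.inv ≫ g, by simp [hg]⟩
  | zero hx => exact ⟨0, hx.eq_of_src _ _⟩
  | sum t ht _ _ ih ih' =>
    obtain ⟨g, hg⟩ := ih (t.inl ≫ f)
    obtain ⟨g', hg'⟩ := ih' (t.inr ≫ f)
    refine ⟨t.fst ≫ g + t.snd ≫ g', ?_⟩
    rw [Preadditive.add_comp, Category.assoc, Category.assoc, hg, hg', ← Category.assoc,
      ← Category.assoc t.snd, ← Preadditive.add_comp, binaryBicone_total ⟨ht⟩, Category.id_comp]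
  | summand t ht _ ih =>
    obtain ⟨g, hg⟩ := ih (t.fst ≫ f)
    exact ⟨t.inl ≫ g, by simp [hg]⟩

theorem exists_cofactor_of_addClosure {C : Type u} [Category.{v} C] [Preadditive C]
    {P : ObjectProperty C} {s y : C} {i : y ⟶ s}
    (h : ∀ x, P x → ∀ f : y ⟶ x, ∃ g : s ⟶ x, i ≫ g = f) {x : C} (hx : AddClosure P x)
    (f : y ⟶ x) : ∃ g : s ⟶ x, i ≫ g = f := by
  obtain ⟨g, hg⟩ := exists_factor_of_addClosure (P := P.op) (p := i.op) (fun x hx f => by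
    obtain ⟨g, hg⟩ := h x.unop hx f.unop
    exact ⟨g.op, Quiver.Hom.unop_inj hg⟩) (addClosure_op hx) f.op
  exact ⟨g.unop, congrArg Quiver.Hom.unop hg⟩

namespace ExtData

variable {k : Type z} [Field k] {C : Type u} [Category.{v} C] [Preadditive C] [Linear k C]
  {D : ExtData.{w} k C} {R : ObjectProperty C}

/-! ### Heredity and the 0-Auslander condition in the ideal quotient -/

section Quotient

theorem IsHereditary.quotient (hH : D.IsHereditary) (hR : R ≤ D.projInj) :
    (D.quotient R hR).IsHereditary := by
  rintro x a b c f g ⟨δ, h⟩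
  obtain ⟨x, rfl⟩ := exists_eq_toIdealQuotient_obj x
  obtain ⟨a, rfl⟩ := exists_eq_toIdealQuotient_obj a
  obtain ⟨c, rfl⟩ := exists_eq_toIdealQuotient_obj c
  obtain ⟨b₀, f₀, g₀, e, h₀, rfl, h₂⟩ := exists_of_quotient_realizes hR h
  obtain ⟨hex, hsurj⟩ := hH x f₀ g₀ ⟨_, h₀⟩
  have hex' : Function.Exact
      ((D.quotient R hR).push ((toIdealQuotient k R).obj x) ((toIdealQuotient k R).map f₀))
      ((D.quotient R hR).push ((toIdealQuotient k R).obj x) ((toIdealQuotient k R).map g₀)) := hex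
  have hsurj' : Function.Surjective
      ((D.quotient R hR).push ((toIdealQuotient k R).obj x) ((toIdealQuotient k R).map g₀)) := hsurj
  have hg : g = e.inv ≫ (toIdealQuotient k R).map g₀ := by rw [← h₂, Iso.inv_hom_id_assoc]
  refine ⟨fun η => ⟨fun hη => ?_, ?_⟩, fun η => ?_⟩
  · rw [hg, LinBifunctor.push_comp_apply] at hη
    obtain ⟨θ, hθ⟩ := (hex' _).1 hη
    refine ⟨θ, ?_⟩
    rw [LinBifunctor.push_comp_apply, hθ, ← LinBifunctor.push_comp_apply, Iso.inv_hom_id,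
      LinBifunctor.push_id_apply]
  · rintro ⟨θ, rfl⟩
    rw [← LinBifunctor.push_comp_apply, Category.assoc, h₂, LinBifunctor.push_comp_apply]
    exact (hex' _).2 ⟨θ, rfl⟩
  · obtain ⟨θ, rfl⟩ := hsurj' η
    refine ⟨(D.quotient R hR).push _ e.hom θ, ?_⟩
    rw [← LinBifunctor.push_comp_apply, h₂]

theorem IsZeroAuslander.quotient (h : D.IsZeroAuslander) (hR : R ≤ D.projInj) :
    (D.quotient R hR).IsZeroAuslander where
  isExtriangulated := quotient_isExtriangulated h.isExtriangulated hR
  hereditary := h.hereditary.quotient hR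
  enoughProjectives x := by
    obtain ⟨q, p, hq, a, i, δ, hδ⟩ := h.enoughProjectives x.as
    exact ⟨_, _, fun y => hq y.as, _, _, _, quotient_realizes_map hR hδ⟩
  exists_inflation x hx := by
    obtain ⟨q, p, hq, a, i, δ, hδ⟩ := h.exists_inflation x.as fun y => hx ⟨y⟩
    exact ⟨_, _, ⟨fun y => hq.1 y.as, fun y => hq.2 y.as⟩, _, _, _, quotient_realizes_map hR hδ⟩

end Quotient

/-! ### Dual statements for `R₋` and left approximations -/

section Dual

variable (h : D.IsZeroAuslander) (hR : R ≤ D.rightOrth R)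
include h

theorem IsZeroAuslander.bongartzMin_le_rightOrth_leftOrth :
    D.bongartzMin R ≤ D.rightOrth (D.leftOrth R) := by
  intro x hx y hy
  have hD := h.isExtriangulated
  have := bongartzMax_le_leftOrth_rightOrth hD.op (h.hereditary.op hD) (Opposite.op x)
    (by rw [op_bongartzMax]; exact hx)
  exact this (Opposite.op y) (by rw [op_rightOrth]; exact hy)

include hR

theorem IsZeroAuslander.bongartzMin_le_leftOrth : D.bongartzMin R ≤ D.leftOrth R := by
  intro x hx
  have hD := h.isExtriangulated
  have := bongartzMax_le_rightOrth hD.op (op_le_rightOrth hR) (Opposite.op x)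
    (by rw [op_bongartzMax]; exact hx)
  rwa [op_rightOrth] at this

theorem IsZeroAuslander.bongartzMin_le_rightOrth : D.bongartzMin R ≤ D.rightOrth R :=
  fun x hx r hr => h.bongartzMin_le_rightOrth_leftOrth x hx r fun r' hr' => hR r' hr' r hr

theorem IsZeroAuslander.bongartzMin_of_inj (hB : D.AdmitsBongartz R) {x : C} (hx : D.leftOrth R x)
    (hx' : ∀ y, D.rightOrth R y → D.leftOrth R y → ∀ δ : D.obj y x, δ = 0) :
    D.bongartzMin R x := by
  have := h.op.bongartzMax_of_proj (op_le_rightOrth hR) hB.op (x := Opposite.op x)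
    (by rw [op_rightOrth]; exact hx) fun y hy hy' => by
      rw [op_rightOrth] at hy
      rw [op_leftOrth] at hy'
      exact hx' y.unop hy' hy
  rwa [op_bongartzMax] at this

omit hR in
theorem IsZeroAuslander.exists_leftApprox {Q : ObjectProperty C} (hQ : Q ≤ D.rightOrth Q)
    (hRQ : R ≤ Q) (hB : D.AdmitsBongartz Q) {x : C}
    (hx : ∀ y, D.rightOrth R y → ∀ δ : D.obj x y, δ = 0) :
    ∃ (s m : C) (f : x ⟶ s) (g : s ⟶ m), IsLeftApprox (D.addProjInj Q) f ∧ D.rightOrth R m ∧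
      D.leftOrth R m ∧ D.IsConflation f g := by
  obtain ⟨s, m, f, g, hg, h₁, h₂, δ, hδ⟩ := h.op.exists_rightApprox (op_le_rightOrth hQ)
    (ObjectProperty.op_monotone hRQ) hB.op (y := Opposite.op x) fun y hy => by
      rw [op_leftOrth] at hy
      exact hx y.unop hy
  rw [op_addProjInj, isRightApprox_op_iff] at hg
  rw [op_rightOrth] at h₁
  rw [op_leftOrth] at h₂
  exact ⟨s.unop, m.unop, g.unop, f.unop, hg, h₂, h₁, δ, hδ⟩

end Dual

/-! ### Projectives and injectives of `Z_R`, and reduction of larger rigid subcategories -/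

section Main

theorem IsRigid.le_rightOrth (hR : D.IsRigid R) : R ≤ D.rightOrth R :=
  fun y hy x hx δ => congrArg ULift.down (hR.ext_eq_zero 0 x y hx hy (ULift.up.{u} δ))

variable (h : D.IsZeroAuslander) (hR : R ≤ D.rightOrth R)
include h

theorem IsZeroAuslander.rightPerp_bongartzMax :
    D.rightPerp (D.bongartzMax R) = D.rightPerp R := by
  have hD := h.isExtriangulated
  refine funext fun y => propext ?_
  rw [h.hereditary.rightPerp_iff hD, h.hereditary.rightPerp_iff hD]
  exact ⟨fun hy x hx => hy x (.of (Or.inl (Or.inl hx))),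
    fun hy x hx => bongartzMax_le_leftOrth_rightOrth hD h.hereditary x hx y hy⟩

theorem IsZeroAuslander.leftPerp_bongartzMin :
    D.leftPerp (D.bongartzMin R) = D.leftPerp R := by
  have hD := h.isExtriangulated
  refine funext fun y => propext ?_
  rw [h.hereditary.leftPerp_iff hD, h.hereditary.leftPerp_iff hD]
  exact ⟨fun hy x hx => hy x (.of (Or.inl (Or.inl hx))),
    fun hy x hx => h.bongartzMin_le_rightOrth_leftOrth x hx y hy⟩

theorem IsZeroAuslander.zProp_iff {y : C} : D.zProp R y ↔ D.rightOrth R y ∧ D.leftOrth R y :=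
  h.hereditary.zProp_iff h.isExtriangulated

theorem IsZeroAuslander.obj_eq_zero_of_onZ_proj {x : D.ZCat R} (hx : (D.onZ R).proj x) {y : C}
    (hy : D.rightOrth R y) (hy' : D.leftOrth R y) (δ : D.obj x.obj y) : δ = 0 :=
  hx ⟨y, h.zProp_iff.2 ⟨hy, hy'⟩⟩ δ

theorem IsZeroAuslander.obj_eq_zero_of_onZ_inj {x : D.ZCat R} (hx : (D.onZ R).inj x) {y : C}
    (hy : D.rightOrth R y) (hy' : D.leftOrth R y) (δ : D.obj y x.obj) : δ = 0 :=
  hx ⟨y, h.zProp_iff.2 ⟨hy, hy'⟩⟩ δ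

include hR

theorem IsZeroAuslander.bongartzMax_iff (hB : D.AdmitsBongartz R) (x : C) :
    D.bongartzMax R x ↔ ∃ hx : D.zProp R x, (D.onZ R).proj ⟨x, hx⟩ := by
  have hD := h.isExtriangulated
  have hH := h.hereditary
  refine ⟨fun hx => ⟨h.zProp_iff.2 ⟨bongartzMax_le_rightOrth hD hR x hx,
    bongartzMax_le_leftOrth hD hR hH x hx⟩, fun y => ?_⟩, fun ⟨hx, hx'⟩ => ?_⟩
  · exact bongartzMax_le_leftOrth_rightOrth hD hH x hx y.obj (h.zProp_iff.1 y.property).1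
  · exact h.bongartzMax_of_proj hR hB (h.zProp_iff.1 hx).1 fun y hy hy' =>
      h.obj_eq_zero_of_onZ_proj hx' hy hy'

theorem IsZeroAuslander.bongartzMin_iff (hB : D.AdmitsBongartz R) (x : C) :
    D.bongartzMin R x ↔ ∃ hx : D.zProp R x, (D.onZ R).inj ⟨x, hx⟩ := by
  refine ⟨fun hx => ⟨h.zProp_iff.2 ⟨h.bongartzMin_le_rightOrth hR x hx,
    h.bongartzMin_le_leftOrth hR x hx⟩, fun y => ?_⟩, fun ⟨hx, hx'⟩ => ?_⟩
  · exact h.bongartzMin_le_rightOrth_leftOrth x hx y.obj (h.zProp_iff.1 y.property).2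
  · exact h.bongartzMin_of_inj hR hB (h.zProp_iff.1 hx).2 fun y hy hy' =>
      h.obj_eq_zero_of_onZ_inj hx' hy hy'

theorem IsZeroAuslander.onZ (hB : D.AdmitsBongartz R) : (D.onZ R).IsZeroAuslander where
  isExtriangulated := h.hereditary.onZ_isExtriangulated h.isExtriangulated R
  hereditary := h.hereditary.restrict _
  enoughProjectives x := by
    obtain ⟨u, w, f, g, hu, hw, δ, hδ⟩ :=
      h.exists_approxKernel_resolution hB (h.zProp_iff.1 x.property).1
    obtain ⟨hu', -⟩ := (h.bongartzMax_iff hR hB u).1 (.of (Or.inr hu))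
    obtain ⟨hw', hw''⟩ := (h.bongartzMax_iff hR hB w).1 (.of (Or.inr hw))
    exact ⟨⟨w, hw'⟩, ObjectProperty.homMk g, hw'', ⟨u, hu'⟩, ObjectProperty.homMk f, δ, hδ⟩
  exists_inflation x hx := by
    obtain ⟨s, v, f, g, hs, hv, hv', δ, hδ⟩ := h.exists_inflation_of_proj hR hB
      (h.zProp_iff.1 x.property).1 fun y hy hy' => h.obj_eq_zero_of_onZ_proj hx hy hy'
    have hs' := h.zProp_iff.2 ⟨addProjInj_le_rightOrth hR s hs, addProjInj_le_leftOrth hR s hs⟩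
    exact ⟨⟨s, hs'⟩, ObjectProperty.homMk f,
      ⟨fun y => rightOrth_addProjInj (h.zProp_iff.1 y.property).1 s hs,
        fun y => leftOrth_addProjInj (h.zProp_iff.1 y.property).2 s hs⟩,
      ⟨v, h.zProp_iff.2 ⟨hv, hv'⟩⟩, ObjectProperty.homMk g, δ, hδ⟩

/-- Projectivity in `Z_R` supplies an inflation into an object of `add(R, proj ∩ inj)` with cokernel
in `Z_R`; injectivity in `Z_R` splits it. -/
theorem IsZeroAuslander.addProjInj_of_onZ_projInj (hB : D.AdmitsBongartz R) {x : D.ZCat R}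
    (hx : (D.onZ R).projInj x) : D.addProjInj R x.obj := by
  obtain ⟨s, v, f, g, hs, hv, hv', δ, hδ⟩ := h.exists_inflation_of_proj hR hB
    (h.zProp_iff.1 x.property).1 fun y hy hy' => h.obj_eq_zero_of_onZ_proj hx.1 hy hy'
  have h₀ : δ = 0 := h.obj_eq_zero_of_onZ_inj hx.2 hv hv' δ
  subst h₀
  exact h.isExtriangulated.addClosure_left_of_split hδ hs

omit hR

variable {Q : ObjectProperty C} (hQ : Q ≤ D.rightOrth Q) (hRQ : R ≤ Q)
include hQ hRQ

theorem IsZeroAuslander.addProjInj_le_zProp : D.addProjInj Q ≤ D.zProp R :=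
  fun x hx => h.zProp_iff.2 ⟨fun r hr => addProjInj_le_rightOrth hQ x hx r (hRQ r hr),
    fun r hr => addProjInj_le_leftOrth hQ x hx r (hRQ r hr)⟩

theorem IsZeroAuslander.addProjInj_reducedImage {x : C} (hx : D.addProjInj Q x)
    (hz : D.zProp R x) : (D.reduced R).addProjInj (D.reducedImage R Q)
      ((toIdealQuotient k (D.inZ R)).obj ⟨x, hz⟩) := by
  -- In the summand case the complement must also lie in `Z_R` for the bicone to exist there.
  have hsummand {x y : C} (s : BinaryBicone x y) (hs : D.zProp R s.pt) : D.zProp R x := by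
    rw [h.zProp_iff] at hs ⊢
    refine ⟨fun r hr δ => ?_, fun r hr δ => ?_⟩
    · rw [← D.push_id_apply δ, ← s.inl_fst, D.push_comp_apply, hs.1 r hr (D.push r s.inl δ),
        map_zero]
    · rw [← D.pull_id_apply δ, ← s.inl_fst, D.pull_comp_apply, hs.2 r hr (D.pull s.fst r δ),
        map_zero]
  induction hx with
  | @of x hx =>
    refine .of (hx.imp (fun hx => ⟨⟨x, hz⟩, hx, ⟨Iso.refl _⟩⟩) fun hx => ?_)
    exact ⟨fun y => hx.1 y.as.obj, fun y => hx.2 y.as.obj⟩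
  | @iso x y e hx ih =>
    have hx' := h.addProjInj_le_zProp hQ hRQ x hx
    exact .iso ((toIdealQuotient k (D.inZ R)).mapIso
      (ObjectProperty.isoMk _ (X := ⟨x, hx'⟩) (Y := ⟨y, hz⟩) e)) (ih hx')
  | zero hx =>
    refine .zero ((toIdealQuotient k (D.inZ R)).map_isZero ?_)
    rw [IsZero.iff_id_eq_zero]
    exact ObjectProperty.hom_ext _ (hx.eq_of_src _ _)
  | @sum x y s hs hx hy ih ih' =>
    have hx' := h.addProjInj_le_zProp hQ hRQ x hx
    have hy' := h.addProjInj_le_zProp hQ hRQ y hy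
    exact .sum _ (mapBinaryBicone_isBilimit (toIdealQuotient k (D.inZ R))
      (fullSubcategoryBicone_isBilimit hx' hy' hz ⟨hs⟩)).some (ih hx') (ih' hy')
  | @summand x y s hs hx ih =>
    have hs' := h.addProjInj_le_zProp hQ hRQ s.pt hx
    exact .summand _ (mapBinaryBicone_isBilimit (toIdealQuotient k (D.inZ R))
      (fullSubcategoryBicone_isBilimit hz (hsummand (biconeSwap s) hs') hs' ⟨hs⟩)).some (ih hs')

/-- Factorizations need testing only on generators of the additive closure. Maps in the quotient
have representatives in `Z_R`, and the projective-injectives of the quotient come from `add(R, proj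
∩ inj)`, which is contained in `add(Q, proj ∩ inj)`. -/
theorem IsZeroAuslander.isRightApprox_reduced (hB : D.AdmitsBongartz R) {s y : D.ZCat R}
    {p : s ⟶ y} (hp : IsRightApprox (D.addProjInj Q) p.hom) :
    IsRightApprox ((D.reduced R).addProjInj (D.reducedImage R Q))
      ((toIdealQuotient k (D.inZ R)).map p) := by
  have hR : R ≤ D.rightOrth R := fun r hr r' hr' => hQ r (hRQ r hr) r' (hRQ r' hr')
  refine ⟨h.addProjInj_reducedImage hQ hRQ hp.1 s.property, fun x hx f =>
    exists_factor_of_addClosure (fun x hx f => ?_) hx f⟩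
  have key : ∀ x : D.ZCat R, D.addProjInj Q x.obj →
      ∀ f : (toIdealQuotient k (D.inZ R)).obj x ⟶ (toIdealQuotient k (D.inZ R)).obj y,
      ∃ g, g ≫ (toIdealQuotient k (D.inZ R)).map p = f := by
    intro x hx f
    obtain ⟨f, rfl⟩ := (toIdealQuotient k (D.inZ R)).map_surjective f
    obtain ⟨g, hg⟩ := hp.2 _ hx f.hom
    refine ⟨(toIdealQuotient k (D.inZ R)).map (ObjectProperty.homMk g), ?_⟩
    rw [← Functor.map_comp]
    exact congrArg _ (ObjectProperty.hom_ext _ hg)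
  obtain ⟨q, hq, ⟨e⟩⟩ | hx := hx
  · obtain ⟨g, hg⟩ := key q (.of (Or.inl hq)) (e.hom ≫ f)
    exact ⟨e.inv ≫ g, by rw [Category.assoc, hg, Iso.inv_hom_id_assoc]⟩
  · exact key x.as (addProjInj_mono hRQ _ (h.addProjInj_of_onZ_projInj hR hB
      ⟨fun y => hx.1 ⟨y⟩, fun y => hx.2 ⟨y⟩⟩)) f

theorem IsZeroAuslander.isLeftApprox_reduced (hB : D.AdmitsBongartz R) {s y : D.ZCat R}
    {i : y ⟶ s} (hi : IsLeftApprox (D.addProjInj Q) i.hom) :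
    IsLeftApprox ((D.reduced R).addProjInj (D.reducedImage R Q))
      ((toIdealQuotient k (D.inZ R)).map i) := by
  have hR : R ≤ D.rightOrth R := fun r hr r' hr' => hQ r (hRQ r hr) r' (hRQ r' hr')
  refine ⟨h.addProjInj_reducedImage hQ hRQ hi.1 s.property, fun x hx f =>
    exists_cofactor_of_addClosure (fun x hx f => ?_) hx f⟩
  have key : ∀ x : D.ZCat R, D.addProjInj Q x.obj →
      ∀ f : (toIdealQuotient k (D.inZ R)).obj y ⟶ (toIdealQuotient k (D.inZ R)).obj x,
      ∃ g, (toIdealQuotient k (D.inZ R)).map i ≫ g = f := by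
    intro x hx f
    obtain ⟨f, rfl⟩ := (toIdealQuotient k (D.inZ R)).map_surjective f
    obtain ⟨g, hg⟩ := hi.2 _ hx f.hom
    refine ⟨(toIdealQuotient k (D.inZ R)).map (ObjectProperty.homMk g), ?_⟩
    rw [← Functor.map_comp]
    exact congrArg _ (ObjectProperty.hom_ext _ hg)
  obtain ⟨q, hq, ⟨e⟩⟩ | hx := hx
  · obtain ⟨g, hg⟩ := key q (.of (Or.inl hq)) (f ≫ e.inv)
    exact ⟨g ≫ e.hom, by rw [← Category.assoc, hg, Category.assoc, Iso.inv_hom_id,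
      Category.comp_id]⟩
  · exact key x.as (addProjInj_mono hRQ _ (h.addProjInj_of_onZ_projInj hR hB
      ⟨fun y => hx.1 ⟨y⟩, fun y => hx.2 ⟨y⟩⟩)) f

theorem IsZeroAuslander.reducedImage_isRigid (hB : D.AdmitsBongartz R) :
    (D.reduced R).IsRigid (D.reducedImage R Q) where
  closedUnderIso := by unfold reducedImage; infer_instance
  ext_eq_zero n := by
    have hR : R ≤ D.rightOrth R := fun r hr r' hr' => hQ r (hRQ r hr) r' (hRQ r' hr')
    have hred : (D.reduced R).IsZeroAuslander := (h.onZ hR hB).quotient (D.inZ_le_projInj R)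
    cases n with
    | zero =>
      rintro r r' ⟨q, hq, ⟨e⟩⟩ ⟨q', hq', ⟨e'⟩⟩ ⟨δ⟩
      apply ULift.down_injective
      refine (D.reduced R).eq_zero_of_pull_iso e _ ((D.reduced R).eq_zero_of_push_iso e'.symm _ ?_)
      exact hQ _ hq' _ hq _
    | succ n => exact fun _ _ _ _ δ =>
        hred.hereditary.higher_succ_eq_zero hred.isExtriangulated n δ

theorem IsZeroAuslander.reducedImage_admitsBongartz (hB : D.AdmitsBongartz R)
    (hBQ : D.AdmitsBongartz Q) : (D.reduced R).AdmitsBongartz (D.reducedImage R Q) := by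
  have hD := h.isExtriangulated
  have hR : R ≤ D.rightOrth R := fun r hr r' hr' => hQ r (hRQ r hr) r' (hRQ r' hr')
  refine ⟨fun y hy => ?_, fun x hx => ?_⟩
  · have hy' := (h.bongartzMin_iff hR hB y.as.obj).2 ⟨y.as.property, fun x => hy ⟨x⟩⟩
    obtain ⟨s, m, f, g, hg, hm, hm', δ, hδ⟩ := h.exists_rightApprox hQ hRQ hBQ fun x hx =>
      h.bongartzMin_le_rightOrth_leftOrth y.as.obj hy' x hx
    have hs := h.addProjInj_le_zProp hQ hRQ s hg.1
    have hm := h.zProp_iff.2 ⟨hm, hm'⟩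
    exact ⟨_, _, ⟨_, _, _, quotient_realizes_map (D := D.onZ R) (D.inZ_le_projInj R)
      (a := ⟨m, hm⟩) (b := ⟨s, hs⟩) (c := y.as) (f := ObjectProperty.homMk f)
      (g := ObjectProperty.homMk g) (δ := δ) hδ⟩, h.isRightApprox_reduced hQ hRQ hB hg⟩
  · have hx' := (h.bongartzMax_iff hR hB x.as.obj).2 ⟨x.as.property, fun y => hx ⟨y⟩⟩
    obtain ⟨s, m, f, g, hf, hm, hm', δ, hδ⟩ := h.exists_leftApprox hQ hRQ hBQ fun y hy =>
      bongartzMax_le_leftOrth_rightOrth hD h.hereditary x.as.obj hx' y hy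
    have hs := h.addProjInj_le_zProp hQ hRQ s hf.1
    have hm := h.zProp_iff.2 ⟨hm, hm'⟩
    exact ⟨_, _, ⟨_, _, _, quotient_realizes_map (D := D.onZ R) (D.inZ_le_projInj R)
      (a := x.as) (b := ⟨s, hs⟩) (c := ⟨m, hm⟩) (f := ObjectProperty.homMk f)
      (g := ObjectProperty.homMk g) (δ := δ) hδ⟩, h.isLeftApprox_reduced hQ hRQ hB hf⟩

end Main

end ExtData

theorem proposition6p9 {k : Type z} [Field k] {C : Type u} [Category.{v} C] [Preadditive C]
    [Linear k C] (D : ExtData.{w} k C) (hD : D.IsExtriangulated)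
    (R : ObjectProperty C) (hR : D.IsRigid R) :
    (D.IsHereditary →
      ((D.onZ R).IsExtriangulated ∧ (D.onZ R).IsHereditary) ∧
      ((D.reduced R).IsExtriangulated ∧ (D.reduced R).IsHereditary)) ∧
    (D.IsZeroAuslander → D.AdmitsBongartz R →
      (D.rightPerp (D.bongartzMax R) = D.rightPerp R ∧
        D.leftPerp (D.bongartzMin R) = D.leftPerp R) ∧
      ((∀ x : C, D.bongartzMax R x ↔ ∃ hx : D.zProp R x, (D.onZ R).proj ⟨x, hx⟩) ∧
        (∀ x : C, D.bongartzMin R x ↔ ∃ hx : D.zProp R x, (D.onZ R).inj ⟨x, hx⟩)) ∧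
      ((D.onZ R).IsZeroAuslander ∧ (D.reduced R).IsZeroAuslander) ∧
      (∀ Q : ObjectProperty C, D.IsRigid Q → R ≤ Q → D.AdmitsBongartz Q →
        (D.reduced R).IsRigid (D.reducedImage R Q) ∧
        (D.reduced R).AdmitsBongartz (D.reducedImage R Q))) := by
  have hrig := hR.le_rightOrth
  refine ⟨fun hH => ⟨⟨hH.onZ_isExtriangulated hD R, hH.restrict _⟩,
    ExtData.quotient_isExtriangulated (hH.onZ_isExtriangulated hD R) (D.inZ_le_projInj R),
    (hH.restrict _).quotient (D.inZ_le_projInj R)⟩, fun h hB =>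
    ⟨⟨h.rightPerp_bongartzMax, h.leftPerp_bongartzMin⟩,
      ⟨h.bongartzMax_iff hrig hB, h.bongartzMin_iff hrig hB⟩,
      ⟨h.onZ hrig hB, (h.onZ hrig hB).quotient (D.inZ_le_projInj R)⟩, fun Q hQ hRQ hBQ =>
      ⟨h.reducedImage_isRigid hQ.le_rightOrth hRQ hB,
        h.reducedImage_admitsBongartz hQ.le_rightOrth hRQ hB hBQ⟩⟩⟩
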